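/- For $m\ge 1$, a deletion probability $\delta$ and a string of probabilities $S=(p_0,\dots,p_{m-1})\in[0,1]^m$, a trace of $S$ is obtained by drawing independent bits $t_i$ with $\Pr[t_i=1]=p_i$, deleting each bit independently with probability $\delta$, and returning the concatenation of the remaining bits. Write $\mathrm{bin}(n,p,i)=\binom ni p^i(1-p)^{n-i}$. For odd $n\ge 1$ and $\alpha\ge 0$ define strings of length $n+1$, indexed by $i\in\{0,\dots,n\}$: $S_e(i)=\alpha\,\mathrm{bin}(n,\tfrac12,i)$ for even $i$ and $S_e(i)=0$ for odd $i$; $S_o(i)=\alpha\,\mathrm{bin}(n,\tfrac12,i)$ for odd $i$ and $S_o(i)=0$ for even $i$. Theorem. There are absolute constants $c,c',c'',\kappa,\varepsilon>0$ such that the following hold for every odd $n\ge1$. (a) For every $\alpha$ with $0\le\alpha\le c'\sqrt n$, the entries of $S_e$ and $S_o$ lie in $[0,1]$, and for every deletion probability $\delta\le 1$ with $\delta\ge c/\sqrt n$: (i) the total variation distance between the law of a trace of $S_e$ and the law of a trace of $S_o$ is at most $e^{-c''\sqrt n}$; (ii) for every $t\in\mathbb N$, no (randomized) algorithm that is given $t$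 independent traces, all from $S_e$ or all from $S_o$ with probability $\tfrac12$ each, guesses which of the two it was with probability larger than $\tfrac12+t\,e^{-c''\sqrt n}$. (b) For every $\alpha$ with $0\le\alpha\le c'\sqrt n$, the distances between the two strings satisfy $\|S_e-S_o\|_1=\alpha$ and $\kappa\,\alpha/\sqrt n\le\|S_e-S_o\|_\infty\le\alpha/\sqrt n$. In particular, for $\alpha=c'\sqrt n$ the $\ell_1$ distance is $c'\sqrt n$ and the $\ell_\infty$ distance lies in $[\kappa c',c']$. (c) Let $c/\sqrt n\le\delta\le1$, and suppose that a (randomized) algorithm, given $t$ independent traces of an unknown string $S\in[0,1]^{n+1}$, outputs a vector $u\in\mathbb R^{n+1}$ such that, for every $S$, $\|u-S\|_\infty\le\varepsilon$ with probability at least $q$; or such that, for every $S$, $\|u-S\|_1\le\varepsilon\sqrt n$ with probability at least $q$. Then $t\ge(q-\tfrac12)\,e^{c''\sqrt n}$; so reconstruction with any fixed success probability $q>\tfrac12$ needs $2^{\Omega(\sqrt n)}$ traces. -/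

import Mathlib

open MeasureTheory

/-- A length-`m` string of probabilities. -/
abbrev ProbString (m : ℕ) : Type := Fin m → unitInterval

/-- A coin: `true` with probability `p`, `false` with probability `1 - p`. -/
noncomputable def coin (p : unitInterval) : PMF Bool :=
  PMF.ofFintype (fun b => ENNReal.ofReal (if b then (p : ℝ) else 1 - (p : ℝ))) (by
    rw [Fintype.sum_bool, ← ENNReal.ofReal_add] <;>
      simp [p.2.1, p.2.2])

/-- Independent bits, the `i`-th one being `1` with probability the `i`-th entry of the list. -/
noncomputable def sampleBits : List unitInterval → PMF (List Bool)
  | [] => PMF.pure []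
  | p :: S => (coin p).bind fun b => (sampleBits S).bind fun x => PMF.pure (b :: x)

/-- The deletion channel: each bit is deleted independently with probability `δ`, and the
concatenation of the remaining bits is returned. -/
noncomputable def deletionChannel (δ : unitInterval) : List Bool → PMF (List Bool)
  | [] => PMF.pure []
  | b :: x => (coin δ).bind fun deleted => (deletionChannel δ x).bind fun y =>
      PMF.pure (if deleted then y else b :: y)

/-- The law of one trace of the string `S` at deletion probability `δ`. -/
noncomputable def traceLaw (δ : unitInterval) {m : ℕ} (S : ProbString m) : PMF (List Bool) :=
  (sampleBits (List.ofFn S)).bind (deletionChannel δ)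

/-- The law of a list of `t` independent samples from `P`. -/
noncomputable def iidSamples {X : Type} (P : PMF X) : ℕ → PMF (List X)
  | 0 => PMF.pure []
  | t + 1 => P.bind fun x => (iidSamples P t).bind fun l => PMF.pure (x :: l)

/-- Total variation (statistical) distance of two discrete laws. -/
noncomputable def tvDist {X : Type} (P Q : PMF X) : ℝ :=
  (1 / 2) * ∑' x, |(P x).toReal - (Q x).toReal|

/-- `ℓ¹` distance of real vectors. -/
def l1Dist {m : ℕ} (u v : Fin m → ℝ) : ℝ := ∑ i, |u i - v i|

/-- `ℓ^∞` distance of real vectors. -/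
noncomputable def linfDist {m : ℕ} (u v : Fin m → ℝ) : ℝ := ⨆ i, |u i - v i|

/-- The real vector underlying a string of probabilities. -/
def ProbString.toReal {m : ℕ} (S : ProbString m) : Fin m → ℝ := fun i => (S i : ℝ)

/-- A real vector with entries in `[0, 1]`, as a string of probabilities. -/
def toProbString {m : ℕ} (f : Fin m → ℝ) (h : ∀ i, f i ∈ Set.Icc (0 : ℝ) 1) : ProbString m :=
  fun i => ⟨f i, h i⟩

/-- The probability that `n` flips of a `p`-biased coin give `k` heads. -/
noncomputable def bin (n : ℕ) (p : ℝ) (k : ℕ) : ℝ :=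
  (n.choose k : ℝ) * p ^ k * (1 - p) ^ (n - k)

/-- The string `S_e`: scaled binomial probabilities on the even indices in `{0, …, n}`. -/
noncomputable def evenString (n : ℕ) (α : ℝ) : Fin (n + 1) → ℝ :=
  fun i => if Even (i : ℕ) then α * bin n (1 / 2) i else 0

/-- The string `S_o`: scaled binomial probabilities on the odd indices in `{0, …, n}`. -/
noncomputable def oddString (n : ℕ) (α : ℝ) : Fin (n + 1) → ℝ :=
  fun i => if Odd (i : ℕ) then α * bin n (1 / 2) i else 0

/-- A randomized distinguisher: from a list of traces it outputs a random bit
(`true` standing for the first hypothesis, `false` for the second). -/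
abbrev Distinguisher : Type := List (List Bool) → PMF Bool

/-- The probability that the distinguisher `A`, given `t` independent traces from a uniformly
random one of `S` and `T`, guesses correctly which one it was. -/
noncomputable def guessProb (δ : unitInterval) {m : ℕ} (S T : ProbString m) (t : ℕ)
    (A : Distinguisher) : ℝ :=
  (1 / 2) * (((iidSamples (traceLaw δ S) t).bind A) true).toReal +
    (1 / 2) * (((iidSamples (traceLaw δ T) t).bind A) false).toReal

/-- A randomized estimator: from a list of traces it outputs a random real vector, with an
arbitrary Borel law. -/
abbrev Estimator (m : ℕ) : Type := List (List Bool) → ProbabilityMeasure (Fin m → ℝ)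

/-- The probability that the output of the estimator `A`, given `t` independent traces of `S`,
lies in `G`. -/
noncomputable def successProb (δ : unitInterval) {m : ℕ} (S : ProbString m) (t : ℕ)
    (A : Estimator m) (G : Set (Fin m → ℝ)) : ℝ :=
  (∑' l, iidSamples (traceLaw δ S) t l * (A l : Measure (Fin m → ℝ)) G).toReal

/-! Encode finitely supported signed measures on bit strings as the monoid algebra of the free
monoid with its ℓ¹ norm. A trace law is then an ordered product of factors `w + p i • y`, where `w =
δ • 1 + (1 - δ) • z` is the trace of a zero bit and `y` the change caused by a one. The norm of a
difference of two such products is twice the total variation distance.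

Expanding each product at the first position `j` where `y` is chosen makes the difference of the two
laws an alternating binomial average over `j` of `w ^ j * y * (rest)`, the rest being built from the
entries of the same parity as `j` (`orderedProd_parityString_sub`). Split the `n` coins behind `j`
into `s₀ + h` frozen coins and `M` active ones. Up to exponentially small errors, the rest can be
cut off after a window of length `h`. Expanding the window over patterns `G` gives words independent
of `j` with scalar weights, products of binomial probabilities, that vary smoothly with `j`.

The deletion channel cancels such averages. An additional active coin puts a `w` on the right, or on
the left with opposite sign. The scalar part `δ` of `w` commutes with everything, so it turns the
weights into half their difference; the rest of `w` does no harm. If `d`-fold half-differences are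
at most `C * (η + 2 ^ (-d))`, then `M` coins leave `C * (η + (1 - δ / 2) ^ M)`
(`sum_norm_altAvg_le`), which is small for `M` of order `n` and `δ` at least a constant over `√n`.

Smoothness comes from the generating function `(x - 1) ^ a * ((1 + x) / 2) ^ n`, giving `a`-th
differences of the binomial law ℓ¹ size at most `(2 * √a / √n) ^ a`. The Leibniz rule with weights
`t ^ a / a!`, `t = √n / 8`, sums the bound over all patterns at total cost `exp (4 * α)`
(`sum_half_seqDiff_patternWeight_le`); a small multiple of `√n` for `α` is therefore affordable. A
hybrid argument over the `t` samples, and disjoint balls around the two strings, give the statements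
on algorithms. -/

/-! ### The ℓ¹ norm on a monoid algebra. -/

section L1Norm

/-- The `ℓ¹` norm of the coefficients, as an additive group norm on the monoid algebra. -/
noncomputable def l1AddGroupNorm (M : Type*) : AddGroupNorm (MonoidAlgebra ℝ M) where
  toFun f := f.coeff.sum fun _ c => |c|
  map_zero' := by simp
  add_le' f g := by
    classical
    have hsub : (f + g).coeff.support ⊆ f.coeff.support ∪ g.coeff.support := Finsupp.support_add
    rw [Finsupp.sum_of_support_subset _ hsub _ (by simp),
      Finsupp.sum_of_support_subset f.coeff (Finset.subset_union_left (s₂ := g.coeff.support)) _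
        (by simp),
      Finsupp.sum_of_support_subset g.coeff (Finset.subset_union_right (s₁ := f.coeff.support)) _
        (by simp), ← Finset.sum_add_distrib]
    exact Finset.sum_le_sum fun x _ => by simpa using abs_add_le (f.coeff x) (g.coeff x)
  neg' f := by
    simp [Finsupp.sum]
  eq_zero_of_map_eq_zero' f hf := by
    ext x
    have h := (Finset.sum_eq_zero_iff_of_nonneg (fun i _ => abs_nonneg (f.coeff i))).1 hf x
    by_cases hx : x ∈ f.coeff.support
    · simpa using h hx
    · simpa using hx

variable {M : Type*}

noncomputable instance l1NormedAddCommGroup : NormedAddCommGroup (MonoidAlgebra ℝ M) :=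
  (l1AddGroupNorm M).toNormedAddCommGroup

theorem l1_norm_def (f : MonoidAlgebra ℝ M) : ‖f‖ = ∑ x ∈ f.coeff.support, |f.coeff x| := rfl

theorem l1_norm_single (x : M) (r : ℝ) : ‖MonoidAlgebra.single x r‖ = |r| := by
  classical
  change (MonoidAlgebra.single x r).coeff.sum (fun _ c => |c|) = |r|
  rw [MonoidAlgebra.coeff_single, Finsupp.sum_single_index (by simp)]

theorem l1_norm_eq_sum {f : MonoidAlgebra ℝ M} {s : Finset M} (h : f.coeff.support ⊆ s) :
    ‖f‖ = ∑ x ∈ s, |f.coeff x| :=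
  Finsupp.sum_of_support_subset f.coeff h _ (by simp)

theorem sum_abs_coeff_le (f : MonoidAlgebra ℝ M) (s : Finset M) :
    ∑ x ∈ s, |f.coeff x| ≤ ‖f‖ := by
  classical
  rw [l1_norm_eq_sum (f := f) (Finset.subset_union_left (s₂ := s))]
  exact Finset.sum_le_sum_of_subset_of_nonneg Finset.subset_union_right fun _ _ _ => abs_nonneg _

theorem l1_norm_mul_le [Monoid M] (f g : MonoidAlgebra ℝ M) : ‖f * g‖ ≤ ‖f‖ * ‖g‖ := by
  rw [MonoidAlgebra.mul_def, l1_norm_def f, l1_norm_def g, Finset.sum_mul_sum]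
  refine (norm_sum_le _ _).trans (Finset.sum_le_sum fun x _ => ?_)
  refine (norm_sum_le _ _).trans (Finset.sum_le_sum fun y _ => ?_)
  rw [l1_norm_single, abs_mul]

noncomputable instance l1NormedRing [Monoid M] : NormedRing (MonoidAlgebra ℝ M) :=
  { l1NormedAddCommGroup, (inferInstance : Ring (MonoidAlgebra ℝ M)) with
    norm_mul_le := l1_norm_mul_le }

theorem l1_norm_smul [Monoid M] (r : ℝ) (f : MonoidAlgebra ℝ M) : ‖r • f‖ ≤ ‖r‖ * ‖f‖ := by
  have hsub : (r • f).coeff.support ⊆ f.coeff.support := by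
    rw [MonoidAlgebra.coeff_smul]; exact Finsupp.support_smul
  rw [l1_norm_eq_sum hsub, l1_norm_def f, Finset.mul_sum]
  exact Finset.sum_le_sum fun x _ => by simp [abs_mul]

noncomputable instance l1NormedAlgebra [Monoid M] : NormedAlgebra ℝ (MonoidAlgebra ℝ M) :=
  { (inferInstance : Algebra ℝ (MonoidAlgebra ℝ M)) with
    norm_smul_le := l1_norm_smul }

instance l1NormOneClass [Monoid M] : NormOneClass (MonoidAlgebra ℝ M) :=
  ⟨by rw [MonoidAlgebra.one_def, l1_norm_single]; simp⟩

end L1Norm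

/-! ### Trace laws as products in the algebra of bit strings. -/

section TraceAlgebra

/-- Finitely supported signed measures on bit strings, multiplied by concatenation. -/
abbrev TraceAlgebra : Type := MonoidAlgebra ℝ (FreeMonoid Bool)

/-- The point mass at a one-letter string. -/
noncomputable def letter (b : Bool) : TraceAlgebra := MonoidAlgebra.single (FreeMonoid.of b) 1

/-- The law of the trace of a zero bit, in a ring in which `z` stands for the letter `0`. -/
noncomputable def zeroTrace {𝓐 : Type*} [Ring 𝓐] [Algebra ℝ 𝓐] (δ : ℝ) (z : 𝓐) : 𝓐 :=
  δ • (1 : 𝓐) + (1 - δ) • z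

/-- The effect on the trace of replacing a zero bit `z` by a one bit `o`. -/
noncomputable def oneExcess {𝓐 : Type*} [Ring 𝓐] [Algebra ℝ 𝓐] (δ : ℝ) (z o : 𝓐) : 𝓐 :=
  (1 - δ) • (o - z)

/-- The signed measure of a trace of a list of probabilities. -/
noncomputable def traceElem (δ : ℝ) (S : List unitInterval) : TraceAlgebra :=
  (S.map fun p : unitInterval => zeroTrace δ (letter false) +
    (p : ℝ) • oneExcess δ (letter false) (letter true)).prod

theorem coeff_letter_mul_nil (b : Bool) (f : TraceAlgebra) :
    (letter b * f).coeff (FreeMonoid.ofList []) = 0 := by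
  refine MonoidAlgebra.coeff_single_mul_of_forall_mul_ne _ _ fun d h => ?_
  have := congrArg FreeMonoid.toList h
  simp at this

theorem coeff_letter_mul_cons (b b' : Bool) (x : List Bool) (f : TraceAlgebra) :
    (letter b * f).coeff (FreeMonoid.ofList (b' :: x)) =
      if b = b' then f.coeff (FreeMonoid.ofList x) else 0 := by
  split_ifs with h
  · subst h
    rw [letter, MonoidAlgebra.coeff_single_mul_eq_mul_coeff (FreeMonoid.ofList x), one_mul]
    intro y _
    constructor
    · intro h
      have := congrArg FreeMonoid.toList h
      exact FreeMonoid.toList.injective (by simpa using this)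
    · rintro rfl
      rfl
  · refine MonoidAlgebra.coeff_single_mul_of_forall_mul_ne _ _ fun d hd => h ?_
    have := congrArg FreeMonoid.toList hd
    simp at this
    exact this.1

theorem coin_apply_toReal (p : unitInterval) (b : Bool) :
    (coin p b).toReal = if b then (p : ℝ) else 1 - p := by
  rw [coin, PMF.ofFintype_apply, ENNReal.toReal_ofReal]
  split_ifs
  · exact p.2.1
  · linarith [p.2.2]

theorem coin_bind_apply_toReal {X : Type} (p : unitInterval) (f : Bool → PMF X) (x : X) :
    ((coin p).bind f x).toReal = p * (f true x).toReal + (1 - p) * (f false x).toReal := by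
  rw [PMF.bind_apply, tsum_fintype, Fintype.sum_bool, ENNReal.toReal_add, ENNReal.toReal_mul,
    ENNReal.toReal_mul, coin_apply_toReal, coin_apply_toReal]
  · simp
  · exact ENNReal.mul_ne_top (PMF.apply_ne_top _ _) (PMF.apply_ne_top _ _)
  · exact ENNReal.mul_ne_top (PMF.apply_ne_top _ _) (PMF.apply_ne_top _ _)

theorem bind_pure_cons_nil (Q : PMF (List Bool)) (b : Bool) :
    (Q.bind fun y => PMF.pure (b :: y)) [] = 0 := by
  simp [PMF.bind_apply]

theorem bind_pure_cons_cons (Q : PMF (List Bool)) (b b' : Bool) (x : List Bool) :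
    (Q.bind fun y => PMF.pure (b :: y)) (b' :: x) = if b = b' then Q x else 0 := by
  rw [PMF.bind_apply]
  split_ifs with h
  · subst h
    rw [tsum_eq_single x]
    · simp
    · intro y hy
      simp [hy.symm]
  · simp [Ne.symm h]

theorem sampleBits_bind_cons (δ p : unitInterval) (S : List unitInterval) :
    (sampleBits (p :: S)).bind (deletionChannel δ) =
      (coin p).bind fun b => (coin δ).bind fun deleted =>
        ((sampleBits S).bind (deletionChannel δ)).bind fun y =>
          PMF.pure (if deleted then y else b :: y) := by
  simp only [sampleBits, deletionChannel, PMF.bind_bind, PMF.pure_bind]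
  congr 1
  funext b
  rw [PMF.bind_comm]

theorem toReal_sampleBits_bind (δ : unitInterval) (S : List unitInterval) (x : List Bool) :
    ((sampleBits S).bind (deletionChannel δ) x).toReal =
      (traceElem δ S).coeff (FreeMonoid.ofList x) := by
  induction S generalizing x with
  | nil =>
    simp only [sampleBits, deletionChannel, PMF.pure_bind, traceElem, List.map_nil, List.prod_nil,
      MonoidAlgebra.one_def, MonoidAlgebra.coeff_single, PMF.pure_apply]
    by_cases h : x = []
    · subst h
      rw [if_pos rfl, FreeMonoid.ofList_nil, Finsupp.single_eq_same]
      rfl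
    · rw [if_neg h, Finsupp.single_eq_of_ne]
      · rfl
      · intro h'
        exact h (by simpa using congrArg FreeMonoid.toList h')
  | cons p S ih =>
    -- The three summands are the fates of the first bit: deleted, kept as `0`, kept as `1`.
    have hE : traceElem δ (p :: S) = (δ : ℝ) • traceElem δ S +
        ((1 - δ) * (1 - p) : ℝ) • (letter false * traceElem δ S) +
        ((1 - δ) * p : ℝ) • (letter true * traceElem δ S) := by
      rw [traceElem, List.map_cons, List.prod_cons, ← traceElem, zeroTrace, oneExcess]
      simp only [add_mul, smul_mul_assoc, one_mul, smul_sub, sub_mul, mul_sub, smul_smul, sub_smul,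
        mul_one]
      simp only [mul_comm]
      abel
    rw [sampleBits_bind_cons, coin_bind_apply_toReal, coin_bind_apply_toReal,
      coin_bind_apply_toReal, hE]
    simp only [MonoidAlgebra.coeff_add, MonoidAlgebra.coeff_smul, Finsupp.add_apply,
      Finsupp.smul_apply, smul_eq_mul, if_true, PMF.bind_pure, ih, Bool.false_eq_true, if_false]
    cases x with
    | nil =>
      rw [bind_pure_cons_nil, bind_pure_cons_nil, coeff_letter_mul_nil, coeff_letter_mul_nil]
      simp
      ring
    | cons b x =>
      rw [bind_pure_cons_cons, bind_pure_cons_cons, coeff_letter_mul_cons, coeff_letter_mul_cons]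
      rw [apply_ite ENNReal.toReal, apply_ite ENNReal.toReal, ENNReal.toReal_zero, ih x]
      split_ifs <;> ring

theorem toReal_traceLaw (δ : unitInterval) {m : ℕ} (S : ProbString m) (x : List Bool) :
    (traceLaw δ S x).toReal = (traceElem δ (List.ofFn S)).coeff (FreeMonoid.ofList x) :=
  toReal_sampleBits_bind _ _ _

theorem hasSum_abs_sub_traceLaw (δ : unitInterval) {m : ℕ} (S T : ProbString m) :
    HasSum (fun x => |(traceLaw δ S x).toReal - (traceLaw δ T x).toReal|)
      ‖traceElem δ (List.ofFn S) - traceElem δ (List.ofFn T)‖ := by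
  simp_rw [toReal_traceLaw]
  have h : ∀ f : TraceAlgebra, HasSum (fun x => |f.coeff x|) ‖f‖ := fun f =>
    hasSum_sum_of_ne_finset_zero fun x hx => by simpa using hx
  exact h _

end TraceAlgebra

/-! ### Averages against the fair binomial law. -/

section BinomialAverage

/-- The probability that `n` fair coin flips give `i` heads. -/
noncomputable def fairBin (n i : ℕ) : ℝ := (n.choose i : ℝ) / 2 ^ n

theorem fairBin_nonneg (n i : ℕ) : 0 ≤ fairBin n i := by
  unfold fairBin; positivity

theorem fairBin_eq_zero {n i : ℕ} (h : n < i) : fairBin n i = 0 := by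
  simp [fairBin, Nat.choose_eq_zero_of_lt h]

theorem fairBin_succ_succ (n i : ℕ) :
    fairBin (n + 1) (i + 1) = 1 / 2 * (fairBin n i + fairBin n (i + 1)) := by
  simp only [fairBin, Nat.choose_succ_succ, Nat.cast_add, pow_succ, Nat.succ_eq_add_one]
  field_simp

theorem fairBin_succ_zero (n : ℕ) : fairBin (n + 1) 0 = 1 / 2 * fairBin n 0 := by
  simp only [fairBin, Nat.choose_zero_right, pow_succ]
  field_simp

variable {E : Type*} [AddCommGroup E] [Module ℝ E]

/-- The average of a sequence against the fair binomial distribution. -/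
noncomputable def binAvg (n : ℕ) (X : ℕ → E) : E :=
  ∑ i ∈ Finset.range (n + 1), fairBin n i • X i

theorem binAvg_zero (X : ℕ → E) : binAvg 0 X = X 0 := by
  simp [binAvg, fairBin]

theorem binAvg_succ (n : ℕ) (X : ℕ → E) :
    binAvg (n + 1) X = (1 / 2 : ℝ) • (binAvg n X + binAvg n fun i => X (i + 1)) := by
  have h1 : binAvg n X =
      (∑ i ∈ Finset.range (n + 1), fairBin n (i + 1) • X (i + 1)) + fairBin n 0 • X 0 := by
    rw [← Finset.sum_range_succ' (fun i => fairBin n i • X i), Finset.sum_range_succ,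
      fairBin_eq_zero (Nat.lt_succ_self n), zero_smul, add_zero, binAvg]
  rw [h1, binAvg, binAvg, Finset.sum_range_succ', fairBin_succ_zero]
  simp_rw [fairBin_succ_succ, mul_smul, add_smul, smul_add, Finset.sum_add_distrib,
    Finset.smul_sum]
  abel

/-- Vandermonde convolution: the heads among `k + m` coins are those of two independent groups. This
permits freezing `k` coins and averaging over the others. -/
theorem binAvg_add (k m : ℕ) (X : ℕ → E) :
    binAvg (k + m) X = binAvg k fun s => binAvg m fun i => X (s + i) := by
  induction m generalizing X with
  | zero => simp [binAvg_zero]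
  | succ m ih =>
    rw [← add_assoc, binAvg_succ, ih, ih]
    simp_rw [binAvg_succ, add_assoc]
    simp only [binAvg, smul_add, Finset.sum_add_distrib, Finset.smul_sum, smul_smul]
    simp only [mul_comm, mul_assoc]

theorem binAvg_congr {n : ℕ} {X Y : ℕ → E} (h : ∀ i ≤ n, X i = Y i) : binAvg n X = binAvg n Y :=
  Finset.sum_congr rfl fun i hi => by rw [h i (Nat.lt_succ_iff.1 (Finset.mem_range.1 hi))]

theorem binAvg_add_fun (n : ℕ) (X Y : ℕ → E) :
    (binAvg n fun i => X i + Y i) = binAvg n X + binAvg n Y := by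
  simp [binAvg, Finset.sum_add_distrib]

theorem binAvg_sub_fun (n : ℕ) (X Y : ℕ → E) :
    (binAvg n fun i => X i - Y i) = binAvg n X - binAvg n Y := by
  simp [binAvg, smul_sub, Finset.sum_sub_distrib]

theorem binAvg_sum {ι : Type*} (s : Finset ι) (n : ℕ) (X : ι → ℕ → E) :
    (binAvg n fun i => ∑ g ∈ s, X g i) = ∑ g ∈ s, binAvg n (X g) := by
  simp only [binAvg, Finset.smul_sum]
  exact Finset.sum_comm

theorem binAvg_smul (n : ℕ) (c : ℝ) (X : ℕ → E) :
    (binAvg n fun i => c • X i) = c • binAvg n X := by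
  simp only [binAvg, Finset.smul_sum, smul_smul, mul_comm]

theorem binAvg_const (n : ℕ) (c : E) : (binAvg n fun _ => c) = c := by
  induction n with
  | zero => exact binAvg_zero _
  | succ n ih => rw [binAvg_succ, ih, ← two_smul ℝ c, smul_smul]; norm_num

theorem binAvg_mul_left (n : ℕ) (c : ℝ) (x : ℕ → ℝ) :
    (binAvg n fun i => c * x i) = c * binAvg n x := binAvg_smul n c x

theorem binAvg_mono {n : ℕ} {x y : ℕ → ℝ} (h : ∀ i ≤ n, x i ≤ y i) : binAvg n x ≤ binAvg n y :=
  Finset.sum_le_sum fun i hi => mul_le_mul_of_nonneg_left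
    (h i (Nat.lt_succ_iff.1 (Finset.mem_range.1 hi))) (fairBin_nonneg _ _)

theorem binAvg_pow (n : ℕ) (r : ℝ) : (binAvg n fun i => r ^ i) = ((1 + r) / 2) ^ n := by
  induction n with
  | zero => simp [binAvg_zero]
  | succ n ih =>
    rw [binAvg_succ]
    simp_rw [pow_succ' r]
    rw [binAvg_mul_left, ih, smul_eq_mul, pow_succ]
    ring

theorem norm_binAvg_le {F : Type*} [NormedAddCommGroup F] [NormedSpace ℝ F] (n : ℕ) (X : ℕ → F) :
    ‖binAvg n X‖ ≤ binAvg n fun i => ‖X i‖ := by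
  refine (norm_sum_le _ _).trans (Finset.sum_le_sum fun i _ => ?_)
  rw [norm_smul, Real.norm_of_nonneg (fairBin_nonneg _ _), smul_eq_mul]

theorem binAvg_sq_deviation (n : ℕ) : (binAvg n fun i => (2 * (i : ℝ) - n) ^ 2) = (n : ℝ) := by
  induction n with
  | zero => simp [binAvg_zero]
  | succ n ih =>
    rw [binAvg_succ, ← binAvg_add_fun, smul_eq_mul]
    have : (fun i : ℕ => (2 * (i : ℝ) - (n + 1 : ℕ)) ^ 2 + (2 * ((i + 1 : ℕ) : ℝ) - (n + 1 : ℕ)) ^ 2)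
        = fun i : ℕ => 2 * (2 * (i : ℝ) - n) ^ 2 + 2 := by
      funext i; push_cast; ring
    rw [this, binAvg_add_fun, binAvg_mul_left, ih, binAvg_const]
    push_cast; ring

/-- The variance controls the first moment through `|y| ≤ y ^ 2 / (2 * √n) + √n / 2`. -/
theorem binAvg_abs_deviation_le (n : ℕ) : (binAvg n fun i => |2 * (i : ℝ) - n|) ≤ √n := by
  rcases Nat.eq_zero_or_pos n with rfl | hn
  · simp [binAvg_zero]
  have hs : 0 < √(n : ℝ) := by positivity
  have h : (binAvg n fun i => |2 * (i : ℝ) - n|) ≤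
      binAvg n fun i => (1 / (2 * √(n : ℝ))) * (2 * (i : ℝ) - n) ^ 2 + √n / 2 := by
    refine binAvg_mono fun i _ => ?_
    have := sq_nonneg (|2 * (i : ℝ) - n| - √n)
    rw [← sq_abs (2 * (i : ℝ) - n)]
    generalize |2 * (i : ℝ) - n| = y at *
    rw [← sub_nonneg]
    have e : 1 / (2 * √(n : ℝ)) * y ^ 2 + √n / 2 - y = (y - √n) ^ 2 / (2 * √n) := by
      field_simp; ring
    rw [e]; positivity
  refine h.trans (le_of_eq ?_)
  rw [binAvg_add_fun, binAvg_mul_left, binAvg_sq_deviation, binAvg_const]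
  have := Real.mul_self_sqrt (Nat.cast_nonneg (α := ℝ) n)
  field_simp
  nlinarith

end BinomialAverage

/-! ### Noncommutative ordered products and their expansions. -/

section OrderedProduct

/-- The ordered product `x a * x (a + 1) * ⋯ * x (a + m - 1)`. -/
def orderedProd {R : Type*} [Monoid R] (x : ℕ → R) : ℕ → ℕ → R
  | _, 0 => 1
  | a, m + 1 => x a * orderedProd x (a + 1) m

theorem orderedProd_add {R : Type*} [Monoid R] (x : ℕ → R) (a m k : ℕ) :
    orderedProd x a (m + k) = orderedProd x a m * orderedProd x (a + m) k := by
  induction m generalizing a with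
  | zero => simp [orderedProd]
  | succ m ih =>
    rw [Nat.add_right_comm, orderedProd, ih, orderedProd, mul_assoc, Nat.add_right_comm a 1 m,
      add_assoc a m 1]

theorem orderedProd_succ {R : Type*} [Monoid R] (x : ℕ → R) (a m : ℕ) :
    orderedProd x a (m + 1) = orderedProd x a m * x (a + m) := by
  rw [orderedProd_add]; simp [orderedProd]

theorem orderedProd_congr {R : Type*} [Monoid R] {x y : ℕ → R} {a m : ℕ}
    (h : ∀ j < m, x (a + j) = y (a + j)) : orderedProd x a m = orderedProd y a m := by
  induction m with
  | zero => rfl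
  | succ m ih =>
    rw [orderedProd_succ, orderedProd_succ, ih fun j hj => h j (hj.trans (Nat.lt_succ_self m)),
      h m (Nat.lt_succ_self m)]

theorem orderedProd_const {R : Type*} [Monoid R] (w : R) (a m : ℕ) :
    orderedProd (fun _ => w) a m = w ^ m := by
  induction m with
  | zero => simp [orderedProd]
  | succ m ih => rw [orderedProd_succ, ih, pow_succ]

theorem prod_ofFn_eq_orderedProd {R : Type*} [Monoid R] (x : ℕ → R) (a m : ℕ) :
    (List.ofFn fun i : Fin m => x (a + i)).prod = orderedProd x a m := by
  induction m generalizing a with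
  | zero => simp [orderedProd]
  | succ m ih =>
    rw [List.ofFn_succ, List.prod_cons, orderedProd, ← ih]
    simp [Nat.add_comm, Nat.add_left_comm]

variable {R : Type*} [NormedRing R]

theorem norm_orderedProd_le_one [NormOneClass R] {x : ℕ → R} (hx : ∀ i, ‖x i‖ ≤ 1) (a m : ℕ) :
    ‖orderedProd x a m‖ ≤ 1 := by
  induction m with
  | zero => simp [orderedProd]
  | succ m ih =>
    rw [orderedProd_succ]
    exact (norm_mul_le _ _).trans (mul_le_one₀ ih (norm_nonneg _) (hx _))

theorem norm_orderedProd_sub_le [NormOneClass R] {x y : ℕ → R} (hx : ∀ i, ‖x i‖ ≤ 1) (hy : ∀ i, ‖y i‖ ≤ 1)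
    (a m : ℕ) : ‖orderedProd x a m - orderedProd y a m‖ ≤
      ∑ j ∈ Finset.range m, ‖x (a + j) - y (a + j)‖ := by
  induction m with
  | zero => simp [orderedProd]
  | succ m ih =>
    rw [orderedProd_succ, orderedProd_succ, Finset.sum_range_succ]
    have e : orderedProd x a m * x (a + m) - orderedProd y a m * y (a + m) =
        (orderedProd x a m - orderedProd y a m) * x (a + m) +
          orderedProd y a m * (x (a + m) - y (a + m)) := by noncomm_ring
    rw [e]
    refine (norm_add_le _ _).trans (add_le_add ?_ ?_)
    · refine (norm_mul_le _ _).trans ?_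
      exact (mul_le_of_le_one_right (norm_nonneg _) (hx _)).trans ih
    · refine (norm_mul_le _ _).trans ?_
      exact mul_le_of_le_one_left (norm_nonneg _) (norm_orderedProd_le_one hy _ _)

/-- Classify the terms by the first position at which `y` is chosen: all earlier letters are `w`,
the later factors stay unexpanded. -/
theorem orderedProd_add_smul [NormedAlgebra ℝ R] (w y : R) (p : ℕ → ℝ) (a m : ℕ) :
    orderedProd (fun i => w + p i • y) a m = w ^ m + ∑ j ∈ Finset.range m,
      p (a + j) • (w ^ j * y *
        orderedProd (fun i => w + p i • y) (a + j + 1) (m - 1 - j)) := by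
  induction m generalizing a with
  | zero => simp [orderedProd]
  | succ m ih =>
    rw [Finset.sum_range_succ', orderedProd, add_mul]
    nth_rewrite 1 [ih]
    rw [mul_add, ← pow_succ', Finset.mul_sum, add_assoc]
    congr 1
    congr 1
    · refine Finset.sum_congr rfl fun j _ => ?_
      rw [mul_smul_comm, pow_succ']
      simp only [mul_assoc]
      rw [show a + (j + 1) = a + 1 + j by ring, show m + 1 - 1 - (j + 1) = m - 1 - j by omega]
    · simp

/-- The word with letters `y` at the positions in `G` and `w` elsewhere. -/
def patternWord {R : Type*} [Monoid R] (w y : R) (h : ℕ) (G : Finset ℕ) : R :=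
  orderedProd (fun g => if g ∈ G then y else w) 0 h

theorem norm_patternWord_le [NormOneClass R] {w y : R} (hw : ‖w‖ ≤ 1) (hy : ‖y‖ ≤ 2) (h : ℕ) (G : Finset ℕ) :
    ‖patternWord w y h G‖ ≤ 2 ^ (G ∩ Finset.range h).card := by
  induction h with
  | zero => simp [patternWord, orderedProd]
  | succ h ih =>
    rw [patternWord, orderedProd_succ, zero_add]
    refine (norm_mul_le _ _).trans ?_
    by_cases hh : h ∈ G
    · rw [if_pos hh, Finset.range_add_one, Finset.inter_insert_of_mem hh,
        Finset.card_insert_of_notMem (by simp), pow_succ]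
      exact mul_le_mul ih hy (norm_nonneg _) (by positivity)
    · rw [if_neg hh, Finset.range_add_one, Finset.inter_insert_of_notMem hh]
      exact (mul_le_of_le_one_right (norm_nonneg _) hw).trans ih

/-- The words do not depend on the starting point `a`, only the scalar weights do; windows at
different places can thus be averaged pattern by pattern. -/
theorem orderedProd_eq_sum_patternWord [NormedAlgebra ℝ R] (w y : R) (p : ℕ → ℝ) (a h : ℕ) :
    orderedProd (fun i => w + p i • y) a h =
      ∑ G ∈ (Finset.range h).powerset, (∏ g ∈ G, p (a + g)) • patternWord w y h G := by
  induction h with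
  | zero => simp [orderedProd, patternWord]
  | succ h ih =>
    rw [orderedProd_succ, ih, Finset.range_add_one, Finset.sum_powerset_insert (by simp), mul_add,
      Finset.sum_mul, Finset.sum_mul]
    congr 1
    · refine Finset.sum_congr rfl fun G hG => ?_
      have hh : h ∉ G := fun hm => by simpa using Finset.mem_powerset.1 hG hm
      rw [patternWord, patternWord, orderedProd_succ, zero_add, if_neg hh, smul_mul_assoc]
    · refine Finset.sum_congr rfl fun G hG => ?_
      have hh : h ∉ G := fun hm => by simpa using Finset.mem_powerset.1 hG hm
      rw [patternWord, patternWord, orderedProd_succ, zero_add, if_pos (Finset.mem_insert_self _ _),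
        Finset.prod_insert hh, smul_mul_assoc, mul_smul_comm, smul_smul, mul_comm (p (a + h))]
      congr 2
      refine orderedProd_congr fun j hj => ?_
      simp [hj.ne]

end OrderedProduct

/-! ### Iterated differences of products, summed over patterns. -/

section Differences

/-- The backward-signed difference of a sequence. -/
def seqDiff (f : ℕ → ℝ) (i : ℕ) : ℝ := f i - f (i + 1)

theorem seqDiff_iterate_succ (f : ℕ → ℝ) (a y : ℕ) :
    seqDiff^[a + 1] f y = seqDiff^[a] f y - seqDiff^[a] f (y + 1) := by
  rw [Function.iterate_succ_apply', seqDiff]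

/-- The discrete Leibniz rule. It moves the base point of `g`, which is why later bounds are
required uniformly in the position. -/
theorem seqDiff_iterate_mul (f g : ℕ → ℝ) (a y : ℕ) :
    seqDiff^[a] (fun i => f i * g i) y = ∑ ij ∈ Finset.HasAntidiagonal.antidiagonal a,
      (a.choose ij.1 : ℝ) * (seqDiff^[ij.1] f y * seqDiff^[ij.2] g (y + ij.1)) := by
  induction a generalizing y with
  | zero => simp
  | succ a ih =>
    rw [Finset.sum_antidiagonal_choose_succ_mul
      (fun i j => seqDiff^[i] f y * seqDiff^[j] g (y + i)), seqDiff_iterate_succ, ih, ih,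
      ← Finset.sum_sub_distrib, ← Finset.sum_add_distrib]
    refine Finset.sum_congr rfl fun ij hij => ?_
    have hc : a.choose ij.2 = a.choose ij.1 := by
      rw [← Finset.HasAntidiagonal.mem_antidiagonal.1 hij, Nat.choose_symm_add]
    rw [hc, seqDiff_iterate_succ, seqDiff_iterate_succ,
      show y + 1 + ij.1 = y + ij.1 + 1 by ring, show y + (ij.1 + 1) = y + ij.1 + 1 by ring]
    ring

theorem seqDiff_iterate_shift (f : ℕ → ℝ) (a c y : ℕ) :
    seqDiff^[a] (fun i => f (i + c)) y = seqDiff^[a] f (y + c) := by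
  induction a generalizing y with
  | zero => rfl
  | succ a ih =>
    rw [seqDiff_iterate_succ, seqDiff_iterate_succ, ih, ih, Nat.add_right_comm]

theorem sum_range_sum_antidiagonal_le {u v : ℕ → ℝ} (hu : ∀ i, 0 ≤ u i) (hv : ∀ i, 0 ≤ v i)
    (m : ℕ) : ∑ a ∈ Finset.range m, ∑ ij ∈ Finset.HasAntidiagonal.antidiagonal a, u ij.1 * v ij.2 ≤
      (∑ a ∈ Finset.range m, u a) * ∑ a ∈ Finset.range m, v a := by
  rw [Finset.sum_mul_sum, ← Finset.sum_product', Finset.sum_sigma']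
  rw [← Finset.sum_image (s := (Finset.range m).sigma fun a => Finset.HasAntidiagonal.antidiagonal a)
    (g := fun x => x.2) (f := fun ij : ℕ × ℕ => u ij.1 * v ij.2)]
  · refine Finset.sum_le_sum_of_subset_of_nonneg ?_ fun _ _ _ => mul_nonneg (hu _) (hv _)
    intro ij hij
    obtain ⟨⟨a, x⟩, hx, rfl⟩ := Finset.mem_image.1 hij
    simp only [Finset.mem_sigma, Finset.mem_range, Finset.HasAntidiagonal.mem_antidiagonal, Finset.mem_product]
      at hx ⊢
    omega
  · rintro ⟨a, x⟩ hx ⟨a', x'⟩ hx' h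
    simp only [Finset.coe_sigma, Set.mem_sigma_iff, Finset.mem_coe, Finset.HasAntidiagonal.mem_antidiagonal]
      at hx hx' h
    subst h
    obtain rfl : a = a' := hx.2.symm.trans hx'.2
    rfl

/-- A truncated exponential generating function of the absolute differences of `f` at `y`. -/
noncomputable def diffNorm (m : ℕ) (t : ℝ) (f : ℕ → ℝ) (y : ℕ) : ℝ :=
  ∑ a ∈ Finset.range m, t ^ a / a.factorial * |seqDiff^[a] f y|

theorem diffNorm_nonneg {t : ℝ} (ht : 0 ≤ t) (m : ℕ) (f : ℕ → ℝ) (y : ℕ) :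
    0 ≤ diffNorm m t f y :=
  Finset.sum_nonneg fun _ _ => by positivity

/-- The weights `t ^ a / a!` absorb the binomial coefficients of the Leibniz rule, leaving a Cauchy
product. -/
theorem diffNorm_mul_le {t : ℝ} (ht : 0 ≤ t) (m : ℕ) (f g : ℕ → ℝ) (y : ℕ) :
    diffNorm m t (fun i => f i * g i) y ≤ ∑ a ∈ Finset.range m, ∑ ij ∈ Finset.HasAntidiagonal.antidiagonal a,
      (t ^ ij.1 / ij.1.factorial * |seqDiff^[ij.1] f y|) *
        (t ^ ij.2 / ij.2.factorial * |seqDiff^[ij.2] g (y + ij.1)|) := by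
  refine Finset.sum_le_sum fun a _ => ?_
  rw [seqDiff_iterate_mul]
  refine (mul_le_mul_of_nonneg_left (Finset.abs_sum_le_sum_abs _ _) (by positivity)).trans ?_
  rw [Finset.mul_sum]
  refine Finset.sum_le_sum fun ij hij => le_of_eq ?_
  rw [Finset.HasAntidiagonal.mem_antidiagonal] at hij
  have hc : (a.choose ij.1 : ℝ) * (ij.1.factorial * ij.2.factorial) = a.factorial := by
    rw [← hij]
    have h := Nat.choose_mul_factorial_mul_factorial (Nat.le_add_right ij.1 ij.2)
    rw [Nat.add_sub_cancel_left, mul_assoc] at h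
    exact_mod_cast h
  rw [abs_mul, abs_mul, Nat.abs_cast, ← hc, ← hij, pow_add]
  have : (((ij.1 + ij.2).choose ij.1 : ℕ) : ℝ) ≠ 0 := by
    exact_mod_cast (Nat.choose_pos (Nat.le_add_right _ _)).ne'
  field_simp

/-- The cost of adding one position to a pattern. Summing over that position turns the differences
of `b` into their ℓ¹ bounds `β`, whatever the base point. -/
theorem sum_diffNorm_mul_shift_le {t : ℝ} (ht : 0 ≤ t) {b β : ℕ → ℝ}
    (hb : ∀ s c (Ω : Finset ℕ), ∑ i ∈ Ω, |seqDiff^[s] b (c + i)| ≤ β s)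
    (m : ℕ) (Ω : Finset ℕ) (f : ℕ → ℝ) (y : ℕ) :
    ∑ i ∈ Ω, diffNorm m t (fun x => f x * b (x + 1 + i)) y ≤
      diffNorm m t f y * ∑ a ∈ Finset.range m, t ^ a / a.factorial * β a := by
  have hβ : ∀ s, 0 ≤ β s := fun s => by simpa using hb s 0 ∅
  refine (Finset.sum_le_sum fun i _ => diffNorm_mul_le ht m f _ y).trans ?_
  rw [Finset.sum_comm]
  refine le_trans ?_ (sum_range_sum_antidiagonal_le
    (u := fun a => t ^ a / a.factorial * |seqDiff^[a] f y|)
    (v := fun a => t ^ a / a.factorial * β a) (fun _ => by positivity)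
    (fun a => mul_nonneg (by positivity) (hβ a)) m)
  refine Finset.sum_le_sum fun a _ => ?_
  rw [Finset.sum_comm]
  refine Finset.sum_le_sum fun ij _ => ?_
  rw [← Finset.mul_sum, ← Finset.mul_sum]
  refine mul_le_mul_of_nonneg_left (mul_le_mul_of_nonneg_left ?_ (by positivity)) (by positivity)
  refine le_trans (le_of_eq ?_) (hb ij.2 (y + ij.1 + 1) Ω)
  refine Finset.sum_congr rfl fun i _ => ?_
  have e : (fun x => b (x + 1 + i)) = fun x => b (x + (1 + i)) := by
    funext x
    rw [add_assoc]
  rw [e, seqDiff_iterate_shift, ← add_assoc]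

/-- Double counting of sets with a marked element; it produces the `1 / k!` that makes the sum over
all patterns an exponential series. -/
theorem card_mul_sum_powersetCard_le (Ω : Finset ℕ) (k : ℕ) {Ψ : Finset ℕ → ℝ}
    {Φ : ℕ → Finset ℕ → ℝ} (hΦ : ∀ i G, 0 ≤ Φ i G)
    (h : ∀ i G, i ∉ G → Ψ (insert i G) = Φ i G) :
    ((k + 1 : ℕ) : ℝ) * ∑ G ∈ Ω.powersetCard (k + 1), Ψ G ≤
      ∑ G ∈ Ω.powersetCard k, ∑ i ∈ Ω, Φ i G := by
  have h1 : ((k + 1 : ℕ) : ℝ) * ∑ G ∈ Ω.powersetCard (k + 1), Ψ G =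
      ∑ G ∈ Ω.powersetCard (k + 1), ∑ _i ∈ G, Ψ G := by
    rw [Finset.mul_sum]
    refine Finset.sum_congr rfl fun G hG => ?_
    rw [Finset.sum_const, (Finset.mem_powersetCard.1 hG).2, nsmul_eq_mul]
  have h2 : ∑ G ∈ Ω.powersetCard (k + 1), ∑ _i ∈ G, Ψ G =
      ∑ G ∈ Ω.powersetCard k, ∑ i ∈ Ω \ G, Φ i G := by
    rw [Finset.sum_sigma', Finset.sum_sigma']
    refine Finset.sum_bij' (fun x _ => ⟨x.1.erase x.2, x.2⟩) (fun x _ => ⟨insert x.2 x.1, x.2⟩)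
      ?_ ?_ ?_ ?_ ?_
    · rintro ⟨G, i⟩ hx
      simp only [Finset.mem_sigma, Finset.mem_powersetCard, Finset.mem_sdiff] at hx ⊢
      obtain ⟨⟨hG, hc⟩, hi⟩ := hx
      refine ⟨⟨(Finset.erase_subset _ _).trans hG, ?_⟩, hG hi, Finset.notMem_erase _ _⟩
      rw [Finset.card_erase_of_mem hi, hc, Nat.add_sub_cancel]
    · rintro ⟨G, i⟩ hx
      simp only [Finset.mem_sigma, Finset.mem_powersetCard, Finset.mem_sdiff] at hx ⊢
      obtain ⟨⟨hG, hc⟩, hi, hiG⟩ := hx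
      exact ⟨⟨Finset.insert_subset hi hG, by rw [Finset.card_insert_of_notMem hiG, hc]⟩,
        Finset.mem_insert_self _ _⟩
    · rintro ⟨G, i⟩ hx
      simp only [Finset.mem_sigma] at hx
      simp [Finset.insert_erase hx.2]
    · rintro ⟨G, i⟩ hx
      simp only [Finset.mem_sigma, Finset.mem_sdiff] at hx
      simp [Finset.erase_insert hx.2.2]
    · rintro ⟨G, i⟩ hx
      simp only [Finset.mem_sigma] at hx
      dsimp only
      rw [← h _ _ (Finset.notMem_erase i G), Finset.insert_erase hx.2]
  rw [h1, h2]
  exact Finset.sum_le_sum fun G _ => Finset.sum_le_sum_of_subset_of_nonneg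
    Finset.sdiff_subset fun _ _ _ => hΦ _ _

/-- The product of the values of `b` at the positions `y + 1 + g`, `g ∈ G`. -/
def patternWeight (b : ℕ → ℝ) (G : Finset ℕ) (y : ℕ) : ℝ := ∏ g ∈ G, b (y + 1 + g)

theorem diffNorm_one_le {t : ℝ} (m : ℕ) (y : ℕ) : diffNorm m t (fun _ => 1) y ≤ 1 := by
  have h : ∀ a, seqDiff^[a + 1] (fun _ => (1 : ℝ)) y = 0 := by
    intro a
    rw [Function.iterate_succ_apply]
    have : seqDiff (fun _ => (1 : ℝ)) = fun _ => 0 := by funext; simp [seqDiff]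
    rw [this]
    induction a with
    | zero => rfl
    | succ a ih =>
      rw [Function.iterate_succ_apply]
      have : seqDiff (fun _ => (0 : ℝ)) = fun _ => 0 := by funext; simp [seqDiff]
      rw [this, ih]
  cases m with
  | zero => simp [diffNorm]
  | succ m =>
    rw [diffNorm, Finset.sum_range_succ']
    simp [h]

theorem sum_diffNorm_patternWeight_le {t : ℝ} (ht : 0 ≤ t) {b β : ℕ → ℝ}
    (hb : ∀ s c (Ω : Finset ℕ), ∑ i ∈ Ω, |seqDiff^[s] b (c + i)| ≤ β s)
    (m : ℕ) (Ω : Finset ℕ) (y k : ℕ) :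
    ∑ G ∈ Ω.powersetCard k, diffNorm m t (patternWeight b G) y ≤
      (∑ a ∈ Finset.range m, t ^ a / a.factorial * β a) ^ k / k.factorial := by
  set B := ∑ a ∈ Finset.range m, t ^ a / a.factorial * β a
  have hβ : ∀ s, 0 ≤ β s := fun s => by simpa using hb s 0 ∅
  have hB : 0 ≤ B := Finset.sum_nonneg fun a _ => mul_nonneg (by positivity) (hβ a)
  induction k with
  | zero =>
    have h0 : patternWeight b ∅ = fun _ => 1 := by
      funext x
      simp [patternWeight]
    simpa [h0] using diffNorm_one_le m y
  | succ k ih =>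
    have h := card_mul_sum_powersetCard_le Ω k (Ψ := fun G => diffNorm m t (patternWeight b G) y)
      (Φ := fun i G => diffNorm m t (fun x => patternWeight b G x * b (x + 1 + i)) y)
      (fun i G => diffNorm_nonneg ht _ _ _) (fun i G hi => by
        congr 1
        funext x
        rw [patternWeight, Finset.prod_insert hi, mul_comm, patternWeight])
    have h' : ((k + 1 : ℕ) : ℝ) *
        ∑ G ∈ Ω.powersetCard (k + 1), diffNorm m t (patternWeight b G) y ≤
          B ^ k / k.factorial * B := by
      refine h.trans ?_
      refine (Finset.sum_le_sum fun G _ =>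
        sum_diffNorm_mul_shift_le ht hb m Ω (patternWeight b G) y).trans ?_
      rw [← Finset.sum_mul]
      exact mul_le_mul_of_nonneg_right ih hB
    rw [Nat.factorial_succ, Nat.cast_mul, pow_succ]
    rw [le_div_iff₀ (by positivity)]
    rw [div_mul_eq_mul_div, le_div_iff₀ (by positivity)] at h'
    linarith

theorem sum_pow_card_mul_diffNorm_le {t w : ℝ} (ht : 0 ≤ t) (hw : 0 ≤ w) {b β : ℕ → ℝ}
    (hb : ∀ s c (Ω : Finset ℕ), ∑ i ∈ Ω, |seqDiff^[s] b (c + i)| ≤ β s)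
    (m : ℕ) (Ω : Finset ℕ) (y : ℕ) :
    ∑ G ∈ Ω.powerset, w ^ G.card * diffNorm m t (patternWeight b G) y ≤
      Real.exp (w * ∑ a ∈ Finset.range m, t ^ a / a.factorial * β a) := by
  have hβ : ∀ s, 0 ≤ β s := fun s => by simpa using hb s 0 ∅
  have hB : 0 ≤ ∑ a ∈ Finset.range m, t ^ a / a.factorial * β a :=
    Finset.sum_nonneg fun a _ => mul_nonneg (by positivity) (hβ a)
  refine le_trans ?_ (Real.sum_le_exp_of_nonneg (mul_nonneg hw hB) (Ω.card + 1))
  rw [Finset.sum_powerset]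
  refine Finset.sum_le_sum fun k _ => ?_
  rw [mul_pow, mul_div_assoc]
  refine le_trans (le_of_eq ?_) (mul_le_mul_of_nonneg_left
    (sum_diffNorm_patternWeight_le ht hb m Ω y k) (by positivity))
  rw [Finset.mul_sum]
  exact Finset.sum_congr rfl fun G hG => by rw [(Finset.mem_powersetCard.1 hG).2]

/-- Half-differences of pattern weights, summed over all patterns, decay geometrically up to
order `m`. -/
theorem sum_half_seqDiff_patternWeight_le {t w C : ℝ} (hw : 0 ≤ w) {b β : ℕ → ℝ}
    (hb : ∀ s c (Ω : Finset ℕ), ∑ i ∈ Ω, |seqDiff^[s] b (c + i)| ≤ β s)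
    {m : ℕ} (hmt : (m : ℝ) ≤ t)
    (hC : Real.exp (w * ∑ a ∈ Finset.range (m + 1), t ^ a / a.factorial * β a) ≤ C)
    (Ω : Finset ℕ) (d y : ℕ) :
    ∑ G ∈ Ω.powerset, w ^ G.card * |(1 / 2) ^ d * seqDiff^[d] (patternWeight b G) y| ≤
      C * ((1 / 2) ^ m + (1 / 2) ^ d) := by
  have hm0 : (0 : ℝ) ≤ m := Nat.cast_nonneg m
  have ht : 0 ≤ t := hm0.trans hmt
  have hC0 : 0 ≤ C := (Real.exp_pos _).le.trans hC
  have small : ∀ d ≤ m, ∀ y,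
      ∑ G ∈ Ω.powerset, w ^ G.card * |(1 / 2) ^ d * seqDiff^[d] (patternWeight b G) y| ≤
        C * (1 / 2) ^ d := by
    intro d hd y
    have key : ∀ G, |(1 / 2 : ℝ) ^ d * seqDiff^[d] (patternWeight b G) y| ≤
        (1 / 2) ^ d * diffNorm (m + 1) t (patternWeight b G) y := by
      intro G
      rw [abs_mul, abs_of_nonneg (by positivity : (0 : ℝ) ≤ (1 / 2) ^ d)]
      refine mul_le_mul_of_nonneg_left ?_ (by positivity)
      refine le_trans ?_ (Finset.single_le_sum
        (f := fun a => t ^ a / a.factorial * |seqDiff^[a] (patternWeight b G) y|)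
        (fun a _ => by positivity) (Finset.mem_range.2 (Nat.lt_succ_of_le hd)))
      -- The weight of order `d` is at least one, since `d! ≤ d ^ d ≤ t ^ d` for `d ≤ m ≤ t`.
      refine le_mul_of_one_le_left (abs_nonneg _) ?_
      rw [one_le_div (by positivity)]
      calc ((d.factorial : ℕ) : ℝ) ≤ (d : ℝ) ^ d := by exact_mod_cast Nat.factorial_le_pow d
        _ ≤ t ^ d := pow_le_pow_left₀ (Nat.cast_nonneg d)
            ((Nat.cast_le.2 hd).trans hmt) d
    calc ∑ G ∈ Ω.powerset, w ^ G.card * |(1 / 2) ^ d * seqDiff^[d] (patternWeight b G) y|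
        ≤ ∑ G ∈ Ω.powerset, w ^ G.card *
            ((1 / 2) ^ d * diffNorm (m + 1) t (patternWeight b G) y) :=
          Finset.sum_le_sum fun G _ => mul_le_mul_of_nonneg_left (key G) (by positivity)
      _ = (1 / 2) ^ d * ∑ G ∈ Ω.powerset, w ^ G.card *
            diffNorm (m + 1) t (patternWeight b G) y := by
          rw [Finset.mul_sum]; exact Finset.sum_congr rfl fun G _ => by ring
      _ ≤ (1 / 2) ^ d * C := mul_le_mul_of_nonneg_left
          ((sum_pow_card_mul_diffNorm_le ht hw hb (m + 1) Ω y).trans hC) (by positivity)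
      _ = C * (1 / 2) ^ d := mul_comm _ _
  -- Beyond order `m` no further decay is claimed: half the difference of two values is at most the
  -- mean of their absolute values, so the bound at `m` persists.
  have large : ∀ e y, ∑ G ∈ Ω.powerset,
      w ^ G.card * |(1 / 2) ^ (m + e) * seqDiff^[m + e] (patternWeight b G) y| ≤
        C * (1 / 2) ^ m := by
    intro e
    induction e with
    | zero => exact fun y => small m le_rfl y
    | succ e ih =>
      intro y
      have step : ∀ G, w ^ G.card *
          |(1 / 2 : ℝ) ^ (m + (e + 1)) * seqDiff^[m + (e + 1)] (patternWeight b G) y| ≤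
          1 / 2 * (w ^ G.card * |(1 / 2) ^ (m + e) * seqDiff^[m + e] (patternWeight b G) y|) +
          1 / 2 * (w ^ G.card *
            |(1 / 2) ^ (m + e) * seqDiff^[m + e] (patternWeight b G) (y + 1)|) := by
        intro G
        rw [← add_assoc, seqDiff_iterate_succ, pow_succ, mul_sub, mul_assoc, mul_assoc]
        rw [← mul_left_comm (1 / 2 : ℝ), ← mul_left_comm (1 / 2 : ℝ), ← mul_sub, abs_mul,
          abs_of_nonneg (by norm_num : (0 : ℝ) ≤ 1 / 2), ← mul_add, ← mul_add,
          mul_left_comm]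
        exact mul_le_mul_of_nonneg_left (mul_le_mul_of_nonneg_left (abs_sub _ _) (by positivity))
          (by norm_num)
      refine (Finset.sum_le_sum fun G _ => step G).trans ?_
      rw [Finset.sum_add_distrib, ← Finset.mul_sum, ← Finset.mul_sum]
      linarith [ih y, ih (y + 1)]
  rcases le_total d m with hd | hd
  · refine (small d hd y).trans (mul_le_mul_of_nonneg_left ?_ hC0)
    exact le_add_of_nonneg_left (by positivity)
  · obtain ⟨e, rfl⟩ := Nat.exists_eq_add_of_le hd
    refine (large e y).trans (mul_le_mul_of_nonneg_left ?_ hC0)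
    exact le_add_of_nonneg_right (by positivity)

end Differences

/-! ### Differences of the binomial law via generating functions. -/

section FairBinDifferences

variable {R : Type*} [CommRing R] [Algebra ℝ R]

theorem binAvg_pow_algebra (n : ℕ) (x : R) :
    (binAvg n fun i => x ^ i) = ((1 / 2 : ℝ) • (1 + x)) ^ n := by
  induction n with
  | zero => simp [binAvg_zero]
  | succ n ih =>
    have h : (binAvg n fun i => x ^ (i + 1)) = x * binAvg n fun i => x ^ i := by
      simp only [binAvg, Finset.mul_sum, mul_smul_comm, pow_succ']
    rw [binAvg_succ, h, ih, pow_succ']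
    simp only [smul_mul_assoc, add_mul, one_mul]

/-- With `f = ((1 + x) / 2) ^ n` and `n = m + 1`, this is the identity for `2 * x * f' - n * f`,
proved by adding coins one at a time. -/
theorem binAvg_deviation_smul_pow (m : ℕ) (x : R) :
    (binAvg (m + 1) fun i => (2 * (i : ℝ) - (m + 1 : ℕ)) • x ^ i) =
      ((m + 1 : ℝ) / 2) • ((x - 1) * ((1 / 2 : ℝ) • (1 + x)) ^ m) := by
  have step : ∀ N : ℕ, (binAvg (N + 1) fun i => (2 * (i : ℝ) - (N + 1 : ℕ)) • x ^ i) =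
      ((1 / 2 : ℝ) • (1 + x)) * (binAvg N fun i => (2 * (i : ℝ) - N) • x ^ i) +
        (1 / 2 : ℝ) • ((x - 1) * ((1 / 2 : ℝ) • (1 + x)) ^ N) := by
    intro N
    rw [binAvg_succ, ← binAvg_add_fun, ← binAvg_pow_algebra, smul_mul_assoc, ← smul_add]
    congr 1
    simp only [binAvg, Finset.mul_sum, ← Finset.sum_add_distrib]
    refine Finset.sum_congr rfl fun i _ => ?_
    simp only [Algebra.smul_def, map_sub, map_mul, map_natCast, map_ofNat, pow_succ]
    push_cast
    ring
  induction m with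
  | zero =>
    rw [step 0]
    simp [binAvg_zero]
  | succ m ih =>
    rw [step (m + 1), ih, pow_succ']
    simp only [Algebra.smul_def]
    push_cast
    have h2 : algebraMap ℝ R (1 / 2) * 2 = 1 := by
      rw [← map_ofNat (algebraMap ℝ R) 2, ← map_mul]; norm_num
    have e1 : algebraMap ℝ R ((m + 1) / 2) = algebraMap ℝ R (1 / 2) * (m + 1) := by
      rw [div_eq_mul_one_div, map_mul, mul_comm]; simp
    have e2 : algebraMap ℝ R ((m + 1 + 1) / 2) = algebraMap ℝ R (1 / 2) * (m + 1 + 1) := by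
      rw [div_eq_mul_one_div, map_mul, mul_comm]; simp
    rw [e1, e2]
    ring

/-- Norms in the preceding identity: the left side is at most the mean absolute deviation, hence at
most `√(m + 1)`. -/
theorem norm_sub_one_mul_pow_le {R : Type*} [NormedCommRing R] [NormOneClass R]
    [NormedAlgebra ℝ R] {x : R} (hx : ‖x‖ ≤ 1) (m : ℕ) :
    ‖(x - 1) * ((1 / 2 : ℝ) • (1 + x)) ^ m‖ ≤ 2 / √((m + 1 : ℕ) : ℝ) := by
  have hm : (0 : ℝ) < (m + 1 : ℕ) := by positivity
  have h := congrArg norm (binAvg_deviation_smul_pow m x)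
  rw [norm_smul, Real.norm_of_nonneg (by positivity)] at h
  have h1 : ‖binAvg (m + 1) fun i => (2 * (i : ℝ) - (m + 1 : ℕ)) • x ^ i‖ ≤
      √((m + 1 : ℕ) : ℝ) := by
    refine (norm_binAvg_le _ _).trans (le_trans (binAvg_mono fun i _ => ?_)
      (binAvg_abs_deviation_le (m + 1)))
    rw [norm_smul, Real.norm_eq_abs]
    refine mul_le_of_le_one_right (abs_nonneg _) ?_
    exact (norm_pow_le _ _).trans (pow_le_one₀ (norm_nonneg _) hx)
  rw [h] at h1
  have hs : 0 < √((m + 1 : ℕ) : ℝ) := Real.sqrt_pos.2 hm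
  rw [le_div_iff₀ hs]
  have hss := Real.mul_self_sqrt hm.le
  push_cast at *
  nlinarith

theorem norm_half_smul_one_add_le {R : Type*} [NormedCommRing R] [NormOneClass R]
    [NormedAlgebra ℝ R] {x : R} (hx : ‖x‖ ≤ 1) : ‖(1 / 2 : ℝ) • (1 + x)‖ ≤ 1 := by
  rw [norm_smul, Real.norm_of_nonneg (by norm_num)]
  have := norm_add_le 1 x
  rw [norm_one] at this
  linarith

theorem norm_sub_one_pow_mul_pow_le {R : Type*} [NormedCommRing R] [NormOneClass R]
    [NormedAlgebra ℝ R] {x : R} (hx : ‖x‖ ≤ 1) (a : ℕ) {n : ℕ} (hn : 0 < n) :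
    ‖(x - 1) ^ a * ((1 / 2 : ℝ) • (1 + x)) ^ n‖ ≤ (2 * √a / √n) ^ a := by
  rcases Nat.eq_zero_or_pos a with rfl | ha
  · simpa using (norm_pow_le _ _).trans
      (pow_le_one₀ (norm_nonneg _) (norm_half_smul_one_add_le hx))
  -- Each factor `x - 1` receives its own `n / a` averaging factors; the `n % a` left over have norm
  -- at most one. Then `a * (n / a + 1) ≥ n` gives the constant.
  have e : (x - 1) ^ a * ((1 / 2 : ℝ) • (1 + x)) ^ n =
      ((x - 1) * ((1 / 2 : ℝ) • (1 + x)) ^ (n / a)) ^ a * ((1 / 2 : ℝ) • (1 + x)) ^ (n % a) := by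
    conv_lhs => rw [← Nat.div_add_mod n a]
    rw [mul_pow, ← pow_mul, pow_add, mul_comm a, mul_assoc]
  rw [e]
  refine (norm_mul_le _ _).trans ?_
  refine (mul_le_of_le_one_right (norm_nonneg _) ((norm_pow_le _ _).trans
      (pow_le_one₀ (norm_nonneg _) (norm_half_smul_one_add_le hx)))).trans ?_
  refine (norm_pow_le _ _).trans (pow_le_pow_left₀ (norm_nonneg _) ?_ _)
  refine (norm_sub_one_mul_pow_le hx _).trans ?_
  have hn' : (0 : ℝ) < n := Nat.cast_pos.2 hn
  have ha' : (0 : ℝ) < a := Nat.cast_pos.2 ha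
  rw [div_le_div_iff₀ (by positivity) (by positivity), mul_assoc, ← Real.sqrt_mul ha'.le]
  refine mul_le_mul_of_nonneg_left (Real.sqrt_le_sqrt ?_) (by norm_num)
  have := Nat.lt_mul_div_succ n ha
  exact_mod_cast this.le

/-- The variable of the algebra of finitely supported sequences. -/
noncomputable def seqVar : MonoidAlgebra ℝ (Multiplicative ℕ) :=
  MonoidAlgebra.single (Multiplicative.ofAdd 1) 1

noncomputable instance l1NormedCommRing : NormedCommRing (MonoidAlgebra ℝ (Multiplicative ℕ)) :=
  { l1NormedRing, (inferInstance : CommRing (MonoidAlgebra ℝ (Multiplicative ℕ))) with }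

theorem coeff_seqVar_sub_one_mul (p : MonoidAlgebra ℝ (Multiplicative ℕ)) (i : ℕ) :
    ((seqVar - 1) * p).coeff (Multiplicative.ofAdd (i + 1)) =
      p.coeff (Multiplicative.ofAdd i) - p.coeff (Multiplicative.ofAdd (i + 1)) := by
  rw [sub_mul, one_mul, MonoidAlgebra.coeff_sub, Finsupp.sub_apply, seqVar,
    MonoidAlgebra.coeff_single_mul_eq_mul_coeff (Multiplicative.ofAdd i), one_mul]
  intro y _
  rw [add_comm, ofAdd_add]
  exact mul_right_inj _

theorem seqVar_pow (i : ℕ) : seqVar ^ i = MonoidAlgebra.single (Multiplicative.ofAdd i) 1 := by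
  rw [seqVar, MonoidAlgebra.single_pow, one_pow, ← ofAdd_nsmul, smul_eq_mul, mul_one]

theorem coeff_half_one_add_pow (n i : ℕ) :
    (((1 / 2 : ℝ) • (1 + seqVar)) ^ n).coeff (Multiplicative.ofAdd i) = fairBin n i := by
  rw [← binAvg_pow_algebra, binAvg, MonoidAlgebra.coeff_sum, Finsupp.finsetSum_apply]
  simp only [seqVar_pow, MonoidAlgebra.coeff_smul, MonoidAlgebra.coeff_single,
    Finsupp.smul_apply, smul_eq_mul]
  rcases Nat.lt_or_ge n i with h | h
  · rw [fairBin_eq_zero h]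
    refine Finset.sum_eq_zero fun j hj => ?_
    rw [Finsupp.single_eq_of_ne, mul_zero]
    intro hij
    have := Multiplicative.ofAdd.injective hij
    have := Finset.mem_range.1 hj
    omega
  · rw [Finset.sum_eq_single i, Finsupp.single_eq_same, mul_one]
    · intro j _ hji
      rw [Finsupp.single_eq_of_ne, mul_zero]
      exact fun hij => hji (Multiplicative.ofAdd.injective hij).symm
    · intro hi
      exact absurd (Finset.mem_range.2 (Nat.lt_succ_of_le h)) hi

/-- The index moves by `a` because a factor `x - 1` yields `p i - p (i + 1)` at degree `i + 1`. -/
theorem seqDiff_iterate_fairBin (n a i : ℕ) :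
    seqDiff^[a] (fairBin n) i =
      ((seqVar - 1) ^ a * ((1 / 2 : ℝ) • (1 + seqVar)) ^ n).coeff
        (Multiplicative.ofAdd (i + a)) := by
  induction a generalizing i with
  | zero => simp only [Function.iterate_zero, id, pow_zero, one_mul, add_zero,
      coeff_half_one_add_pow]
  | succ a ih =>
    rw [seqDiff_iterate_succ, ih, ih, pow_succ', mul_assoc, ← add_assoc,
      coeff_seqVar_sub_one_mul, Nat.add_right_comm i 1 a]

theorem sum_abs_seqDiff_fairBin_le {n : ℕ} (hn : 0 < n) (s c : ℕ) (Ω : Finset ℕ) :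
    ∑ i ∈ Ω, |seqDiff^[s] (fairBin n) (c + i)| ≤ (2 * √s / √n) ^ s := by
  simp_rw [seqDiff_iterate_fairBin]
  refine le_trans ?_ (norm_sub_one_pow_mul_pow_le (x := seqVar)
    (by rw [seqVar, l1_norm_single]; simp) s hn)
  refine le_trans (le_of_eq ?_) (sum_abs_coeff_le _
    (Ω.image fun i => Multiplicative.ofAdd (c + i + s)))
  rw [Finset.sum_image]
  intro i _ j _ hij
  have := Multiplicative.ofAdd.injective hij
  omega

/-- The square root of `a ^ a ≤ e ^ a * a! ≤ 4 ^ a * (a!) ^ 2`. -/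
theorem sqrt_pow_le_two_pow_mul_factorial (a : ℕ) : √(a : ℝ) ^ a ≤ 2 ^ a * a.factorial := by
  have h := Real.pow_div_factorial_le_exp (a : ℝ) (Nat.cast_nonneg a) a
  have hf : (1 : ℝ) ≤ a.factorial := by exact_mod_cast a.factorial_pos
  rw [div_le_iff₀ (by positivity)] at h
  have h4 : Real.exp a ≤ 4 ^ a := by
    rw [← Real.exp_one_pow]
    exact pow_le_pow_left₀ (Real.exp_pos _).le (by linarith [Real.exp_one_lt_d9]) a
  refine abs_le_of_sq_le_sq' ?_ (by positivity) |>.2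
  calc (√(a : ℝ) ^ a) ^ 2 = (a : ℝ) ^ a := by
        rw [← pow_mul, mul_comm, pow_mul, Real.sq_sqrt (Nat.cast_nonneg a)]
    _ ≤ 4 ^ a * a.factorial := h.trans (mul_le_mul_of_nonneg_right h4 (by positivity))
    _ ≤ 4 ^ a * (a.factorial * a.factorial) :=
        mul_le_mul_of_nonneg_left (le_mul_of_one_le_left (by positivity) hf) (by positivity)
    _ = (2 ^ a * a.factorial) ^ 2 := by
        rw [mul_pow, ← pow_mul, mul_comm a 2, pow_mul]; norm_num; ring

/-- The choice `t = √n / 8` cancels `√n` and leaves terms at most `2 ^ (-a)`. -/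
theorem sum_fairBin_egf_le {n : ℕ} (hn : 0 < n) (m : ℕ) :
    ∑ a ∈ Finset.range m, (√(n : ℝ) / 8) ^ a / a.factorial * (2 * √a / √n) ^ a ≤ 2 := by
  have hn' : (0 : ℝ) < √(n : ℝ) := Real.sqrt_pos.2 (Nat.cast_pos.2 hn)
  refine le_trans (Finset.sum_le_sum fun a _ => ?_) (sum_geometric_two_le m)
  have e : (√(n : ℝ) / 8) ^ a / a.factorial * (2 * √a / √n) ^ a =
      (1 / 4) ^ a * (√a ^ a / a.factorial) := by
    rw [div_mul_eq_mul_div, ← mul_pow, show √(n : ℝ) / 8 * (2 * √a / √n) = 1 / 4 * √a by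
      field_simp; ring, mul_pow, mul_div_assoc]
  rw [e]
  calc (1 / 4 : ℝ) ^ a * (√a ^ a / a.factorial) ≤ (1 / 4) ^ a * 2 ^ a := by
        refine mul_le_mul_of_nonneg_left ?_ (by positivity)
        rw [div_le_iff₀ (by positivity)]
        exact sqrt_pow_le_two_pow_mul_factorial a
    _ = (1 / 2) ^ a := by rw [← mul_pow]; norm_num

end FairBinDifferences

/-! ### Cancellation of alternating averages by deletions. -/

section Smoothing

variable {R : Type*} [NormedRing R] [NormedAlgebra ℝ R]

/-- The alternating binomial average of `g i • (w ^ i * v * w ^ (M - i))`. -/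
noncomputable def altAvg (w : R) (M : ℕ) (g : ℕ → ℝ) (v : R) : R :=
  binAvg M fun i => ((-1) ^ i * g i) • (w ^ i * v * w ^ (M - i))

/-- Condition on one coin: tails appends `w` on the right; heads prepends it on the left, flips the
sign and shifts the weights. -/
theorem altAvg_succ (w : R) (M : ℕ) (g : ℕ → ℝ) (v : R) :
    altAvg w (M + 1) g v =
      (1 / 2 : ℝ) • (altAvg w M g v * w - w * altAvg w M (fun i => g (i + 1)) v) := by
  rw [altAvg, binAvg_succ]
  congr 1
  rw [sub_eq_add_neg]
  congr 1
  · rw [altAvg, binAvg, binAvg, Finset.sum_mul]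
    refine Finset.sum_congr rfl fun i hi => ?_
    rw [smul_mul_assoc, smul_mul_assoc, mul_assoc _ _ w, ← pow_succ,
      ← Nat.sub_add_comm (Nat.lt_succ_iff.1 (Finset.mem_range.1 hi))]
  · rw [altAvg, binAvg, binAvg, Finset.mul_sum, ← Finset.sum_neg_distrib]
    refine Finset.sum_congr rfl fun i _ => ?_
    rw [mul_smul_comm, mul_smul_comm, Nat.add_sub_add_right, pow_succ', pow_succ', ← smul_neg,
      ← neg_smul]
    simp only [mul_assoc]
    congr 2
    ring

theorem altAvg_half_sub (w : R) (M : ℕ) (g g' : ℕ → ℝ) (v : R) :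
    altAvg w M (fun i => 1 / 2 * (g i - g' i)) v =
      (1 / 2 : ℝ) • (altAvg w M g v - altAvg w M g' v) := by
  rw [altAvg, altAvg, altAvg, ← binAvg_sub_fun, ← binAvg_smul]
  congr 1
  funext i
  rw [← sub_smul, smul_smul]
  congr 1
  ring

/-- The scalar part of `zeroTrace δ z` acts equally from both sides, so its two contributions merge
into one half-difference. For the `z` part the triangle inequality is enough. -/
theorem norm_altAvg_succ_le {δ : ℝ} (hδ0 : 0 ≤ δ) (hδ1 : δ ≤ 1) {z : R} (hz : ‖z‖ ≤ 1) (M : ℕ)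
    (g : ℕ → ℝ) (v : R) :
    ‖altAvg (zeroTrace δ z) (M + 1) g v‖ ≤
      δ * ‖altAvg (zeroTrace δ z) M (fun i => 1 / 2 * (g i - g (i + 1))) v‖ +
        (1 - δ) * (1 / 2 * (‖altAvg (zeroTrace δ z) M g v‖ +
          ‖altAvg (zeroTrace δ z) M (fun i => g (i + 1)) v‖)) := by
  rw [altAvg_succ, altAvg_half_sub]
  generalize altAvg (zeroTrace δ z) M g v = x
  generalize altAvg (zeroTrace δ z) M (fun i => g (i + 1)) v = y
  have e : (1 / 2 : ℝ) • (x * zeroTrace δ z - zeroTrace δ z * y) =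
      δ • ((1 / 2 : ℝ) • (x - y)) + (1 - δ) • ((1 / 2 : ℝ) • (x * z - z * y)) := by
    rw [zeroTrace]
    simp only [mul_add, add_mul, mul_smul_comm, smul_mul_assoc, mul_one, one_mul, smul_sub,
      smul_add, smul_smul]
    simp only [mul_comm]
    abel
  rw [e]
  refine (norm_add_le _ _).trans (add_le_add ?_ ?_)
  · rw [norm_smul, Real.norm_of_nonneg hδ0]
  · rw [norm_smul, norm_smul, Real.norm_of_nonneg (sub_nonneg.2 hδ1),
      Real.norm_of_nonneg (by norm_num : (0 : ℝ) ≤ 1 / 2)]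
    refine mul_le_mul_of_nonneg_left (mul_le_mul_of_nonneg_left ?_ (by norm_num))
      (sub_nonneg.2 hδ1)
    refine (norm_sub_le _ _).trans (add_le_add ?_ ?_)
    · exact (norm_mul_le _ _).trans (mul_le_of_le_one_right (norm_nonneg _) hz)
    · exact (norm_mul_le _ _).trans (mul_le_of_le_one_left (norm_nonneg _) hz)

/-- If the half-differences of a family of sequences decay, then the deletion channel makes its
alternating averages small. -/
theorem sum_norm_altAvg_le {δ : ℝ} (hδ0 : 0 ≤ δ) (hδ1 : δ ≤ 1) {z : R} (hz : ‖z‖ ≤ 1)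
    {ι : Type*} (s : Finset ι) (v : ι → R) (F : ℕ → ι → ℕ → ℝ)
    (hF : ∀ d G y, F (d + 1) G y = 1 / 2 * (F d G y - F d G (y + 1))) {C η : ℝ}
    (hC : ∀ d y, ∑ G ∈ s, ‖v G‖ * |F d G y| ≤ C * (η + (1 / 2) ^ d)) (M d y : ℕ) :
    ∑ G ∈ s, ‖altAvg (zeroTrace δ z) M (fun i => F d G (y + i)) (v G)‖ ≤
      C * (η + (1 / 2) ^ d * (1 - δ / 2) ^ M) := by
  induction M generalizing d y with
  | zero =>
    simp only [pow_zero, mul_one]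
    refine le_trans (le_of_eq (Finset.sum_congr rfl fun G _ => ?_)) (hC d y)
    simp [altAvg, binAvg_zero, norm_smul, mul_comm]
  | succ M ih =>
    refine (Finset.sum_le_sum fun G _ => norm_altAvg_succ_le hδ0 hδ1 hz M _ (v G)).trans ?_
    rw [Finset.sum_add_distrib, ← Finset.mul_sum, ← Finset.mul_sum, ← Finset.mul_sum,
      Finset.sum_add_distrib]
    have h1 : ∑ G ∈ s, ‖altAvg (zeroTrace δ z) M
        (fun i => 1 / 2 * (F d G (y + i) - F d G (y + (i + 1)))) (v G)‖ ≤
        C * (η + (1 / 2) ^ (d + 1) * (1 - δ / 2) ^ M) := by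
      refine le_trans (le_of_eq (Finset.sum_congr rfl fun G _ => ?_)) (ih (d + 1) y)
      simp only [hF, add_assoc]
    have h2 := ih d y
    have h3 : ∑ G ∈ s, ‖altAvg (zeroTrace δ z) M (fun i => F d G (y + (i + 1))) (v G)‖ ≤
        C * (η + (1 / 2) ^ d * (1 - δ / 2) ^ M) := by
      refine le_trans (le_of_eq (Finset.sum_congr rfl fun G _ => ?_)) (ih d (y + 1))
      simp only [Nat.add_left_comm, Nat.add_comm]
    -- The `η` terms recombine to `η`; the others gain `δ / 2 + (1 - δ) = 1 - δ / 2`.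
    calc _ ≤ δ * (C * (η + (1 / 2) ^ (d + 1) * (1 - δ / 2) ^ M)) +
          (1 - δ) * (1 / 2 * (C * (η + (1 / 2) ^ d * (1 - δ / 2) ^ M) +
            C * (η + (1 / 2) ^ d * (1 - δ / 2) ^ M))) :=
          add_le_add (mul_le_mul_of_nonneg_left h1 hδ0)
            (mul_le_mul_of_nonneg_left (mul_le_mul_of_nonneg_left (add_le_add h2 h3)
              (by norm_num)) (sub_nonneg.2 hδ1))
      _ = C * (η + (1 / 2) ^ d * (1 - δ / 2) ^ (M + 1)) := by ring

end Smoothing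

/-! ### The two strings: expansion, truncation and the norm bound. -/

section ParityStrings

/-- Scaled binomial probabilities on the indices of the same parity as `r`. -/
noncomputable def parityString (n : ℕ) (α : ℝ) (r i : ℕ) : ℝ :=
  if i % 2 = r % 2 then α * fairBin n i else 0

theorem parityString_congr {n : ℕ} {α : ℝ} {r r' : ℕ} (h : r % 2 = r' % 2) :
    parityString n α r = parityString n α r' := by
  funext i; simp only [parityString, h]

theorem parityString_nonneg {n : ℕ} {α : ℝ} (hα : 0 ≤ α) (r i : ℕ) :
    0 ≤ parityString n α r i := by
  unfold parityString
  split_ifs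
  · exact mul_nonneg hα (fairBin_nonneg _ _)
  · exact le_rfl

theorem parityString_le {n : ℕ} {α : ℝ} (hα : 0 ≤ α) (r i : ℕ) :
    parityString n α r i ≤ α * fairBin n i := by
  unfold parityString
  split_ifs
  · exact le_rfl
  · exact mul_nonneg hα (fairBin_nonneg _ _)

/-- Position `j + 1 + g` has the parity of `j` exactly when `g` is odd, so the set of surviving
patterns does not depend on `j`. -/
theorem prod_parityString (n : ℕ) (α : ℝ) (j h : ℕ) {G : Finset ℕ} (hG : G ⊆ Finset.range h) :
    ∏ g ∈ G, parityString n α j (j + 1 + g) =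
      if G ⊆ (Finset.range h).filter Odd then
        α ^ G.card * patternWeight (fairBin n) G j else 0 := by
  split_ifs with hodd
  · rw [patternWeight, ← Finset.prod_const, ← Finset.prod_mul_distrib]
    refine Finset.prod_congr rfl fun g hg => ?_
    have := Nat.odd_iff.1 (Finset.mem_filter.1 (hodd hg)).2
    rw [parityString, if_pos (by omega)]
  · obtain ⟨g, hg, hgo⟩ := Finset.not_subset.1 hodd
    refine Finset.prod_eq_zero hg ?_
    have : ¬ Odd g := fun ho => hgo (Finset.mem_filter.2 ⟨hG hg, ho⟩)
    rw [Nat.odd_iff] at this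
    rw [parityString, if_neg (by omega)]

/-- Markov's inequality for `2 ^ i`, whose binomial mean is `(3 / 2) ^ n`. -/
theorem sum_range_fairBin_tail_le {n a m : ℕ} (h : a + m = n + 1) :
    ∑ i ∈ Finset.range m, fairBin n (a + i) ≤ (1 / 2) ^ a * (3 / 2) ^ n := by
  have h1 : (3 / 2 : ℝ) ^ n = ∑ i ∈ Finset.range (n + 1), fairBin n i * 2 ^ i := by
    have := binAvg_pow n 2
    norm_num at this
    rw [← this]; rfl
  have h2 : ∑ i ∈ Finset.range m, fairBin n (a + i) * 2 ^ (a + i) ≤ (3 / 2) ^ n := by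
    rw [h1, ← h, Finset.sum_range_add]
    exact le_add_of_nonneg_left (Finset.sum_nonneg fun i _ =>
      mul_nonneg (fairBin_nonneg _ _) (by positivity))
  refine le_trans ?_ (mul_le_mul_of_nonneg_left h2 (by positivity))
  rw [Finset.mul_sum]
  refine Finset.sum_le_sum fun i _ => ?_
  have e : (1 / 2 : ℝ) ^ a * (fairBin n (a + i) * 2 ^ (a + i)) = fairBin n (a + i) * 2 ^ i := by
    rw [pow_add, mul_left_comm, ← mul_assoc ((1 / 2 : ℝ) ^ a), ← mul_pow]; norm_num
  rw [e]
  exact le_mul_of_one_le_right (fairBin_nonneg _ _) (one_le_pow₀ (by norm_num))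

variable {R : Type*} [NormedRing R] [NormedAlgebra ℝ R] {δ : ℝ} {z o : R}

theorem norm_zeroTrace_le [NormOneClass R] (hδ0 : 0 ≤ δ) (hδ1 : δ ≤ 1) (hz : ‖z‖ ≤ 1) : ‖zeroTrace δ z‖ ≤ 1 := by
  rw [zeroTrace]
  refine (norm_add_le _ _).trans ?_
  rw [norm_smul, norm_smul, norm_one, Real.norm_of_nonneg hδ0,
    Real.norm_of_nonneg (sub_nonneg.2 hδ1)]
  nlinarith

theorem norm_oneExcess_le (hδ0 : 0 ≤ δ) (hδ1 : δ ≤ 1) (hz : ‖z‖ ≤ 1) (ho : ‖o‖ ≤ 1) :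
    ‖oneExcess δ z o‖ ≤ 2 := by
  rw [oneExcess, norm_smul, Real.norm_of_nonneg (sub_nonneg.2 hδ1)]
  have := norm_sub_le o z
  have := norm_nonneg (o - z)
  nlinarith

theorem norm_bitTrace_le [NormOneClass R] (hδ0 : 0 ≤ δ) (hδ1 : δ ≤ 1) (hz : ‖z‖ ≤ 1) (ho : ‖o‖ ≤ 1) {p : ℝ}
    (hp0 : 0 ≤ p) (hp1 : p ≤ 1) : ‖zeroTrace δ z + p • oneExcess δ z o‖ ≤ 1 := by
  have e : zeroTrace δ z + p • oneExcess δ z o =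
      zeroTrace δ ((1 - p) • z + p • o) := by
    simp only [zeroTrace, oneExcess]
    module
  rw [e]
  refine norm_zeroTrace_le hδ0 hδ1 ((norm_add_le _ _).trans ?_)
  rw [norm_smul, norm_smul, Real.norm_of_nonneg hp0, Real.norm_of_nonneg (sub_nonneg.2 hp1)]
  nlinarith

/-- A first `y` at even `j` occurs only for the even string, at odd `j` only for the odd one. The
subtraction becomes the sign `(-1) ^ j`, and the remaining string is determined by the parity of
`j`. -/
theorem orderedProd_parityString_sub (w y : R) (n : ℕ) (α : ℝ) :
    orderedProd (fun i => w + parityString n α 0 i • y) 0 (n + 1) -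
      orderedProd (fun i => w + parityString n α 1 i • y) 0 (n + 1) =
    α • binAvg n fun j => (-1 : ℝ) ^ j • (w ^ j * y *
      orderedProd (fun i => w + parityString n α j i • y) (j + 1) (n - j)) := by
  rw [orderedProd_add_smul, orderedProd_add_smul, add_sub_add_left_eq_sub,
    ← Finset.sum_sub_distrib, binAvg, Finset.smul_sum]
  refine Finset.sum_congr rfl fun j _ => ?_
  simp only [zero_add, Nat.add_sub_cancel]
  rcases Nat.even_or_odd j with hj | hj
  · have h0 := Nat.even_iff.1 hj
    rw [parityString_congr (n := n) (α := α) (r := j) (r' := 0) (by omega), hj.neg_one_pow,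
      parityString, parityString, if_pos (by omega), if_neg (by omega), zero_smul, sub_zero,
      one_smul, smul_smul]
  · have h0 := Nat.odd_iff.1 hj
    rw [parityString_congr (n := n) (α := α) (r := j) (r' := 1) (by omega), hj.neg_one_pow,
      parityString, parityString, if_neg (by omega), if_pos (by omega), zero_smul, zero_sub,
      neg_smul, one_smul, smul_neg, smul_neg, smul_smul]

theorem norm_windowed_average_le [NormOneClass R] (hδ0 : 0 ≤ δ) (hδ1 : δ ≤ 1) (hz : ‖z‖ ≤ 1) (ho : ‖o‖ ≤ 1)
    {n h M s : ℕ} (hn : 0 < n) (hs : s + M + h ≤ n) {α : ℝ} (hα : 0 ≤ α) :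
    ‖binAvg M fun i => (-1 : ℝ) ^ (s + i) • (zeroTrace δ z ^ (s + i) * oneExcess δ z o *
      (orderedProd (fun x => zeroTrace δ z + parityString n α (s + i) x • oneExcess δ z o)
        (s + i + 1) h * zeroTrace δ z ^ (n - h - (s + i))))‖ ≤
      2 * Real.exp (4 * α) * ((1 / 2) ^ ⌊√(n : ℝ) / 8⌋₊ + (1 - δ / 2) ^ M) := by
  have hw := norm_zeroTrace_le (R := R) hδ0 hδ1 hz
  have hy := norm_oneExcess_le (R := R) hδ0 hδ1 hz ho
  set w := zeroTrace δ z with hwdef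
  set y := oneExcess δ z o
  set Ω := (Finset.range h).filter Odd with hΩ
  set v : Finset ℕ → R := fun G => ((-1 : ℝ) ^ s * α ^ G.card) •
    (w ^ s * y * patternWord w y h G * w ^ (n - h - M - s)) with hv
  have hpow : ∀ a, ‖w ^ a‖ ≤ 1 := fun a => (norm_pow_le _ _).trans (pow_le_one₀ (norm_nonneg _) hw)
  have e : (binAvg M fun i => (-1 : ℝ) ^ (s + i) • (w ^ (s + i) * y *
      (orderedProd (fun x => w + parityString n α (s + i) x • y)
        (s + i + 1) h * w ^ (n - h - (s + i))))) =
      ∑ G ∈ Ω.powerset, altAvg w M (fun i => patternWeight (fairBin n) G (s + i)) (v G) := by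
    simp only [altAvg]
    rw [← binAvg_sum]
    refine binAvg_congr fun i hi => ?_
    have e1 : orderedProd (fun x => w + parityString n α (s + i) x • y) (s + i + 1) h =
        ∑ G ∈ Ω.powerset, (α ^ G.card * patternWeight (fairBin n) G (s + i)) •
          patternWord w y h G := by
      rw [orderedProd_eq_sum_patternWord,
        ← Finset.sum_subset (Finset.powerset_mono.2 (Finset.filter_subset Odd (Finset.range h)))]
      · refine Finset.sum_congr rfl fun G hG => ?_
        have hG' := Finset.mem_powerset.1 hG
        rw [prod_parityString n α (s + i) h (hG'.trans (Finset.filter_subset _ _)), if_pos hG']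
      · intro G hG hG'
        rw [prod_parityString n α (s + i) h (Finset.mem_powerset.1 hG),
          if_neg (fun hh => hG' (Finset.mem_powerset.2 hh)), zero_smul]
    rw [e1, Finset.sum_mul, Finset.mul_sum, Finset.smul_sum]
    refine Finset.sum_congr rfl fun G _ => ?_
    -- Only `w ^ (M - i)` depends on `i`; the fixed power joins `v G`. The natural subtractions are
    -- exact by `s + M + h ≤ n` and `i ≤ M`.
    have e2 : w ^ (n - h - (s + i)) = w ^ (n - h - M - s) * w ^ (M - i) := by
      rw [← pow_add]; congr 1; omega
    have e3 : w ^ (s + i) = w ^ i * w ^ s := by rw [← pow_add, add_comm]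
    rw [hv, e2, e3]
    simp only [smul_mul_assoc, mul_smul_comm, smul_smul, mul_assoc]
    congr 1
    rw [pow_add]; ring
  have hvn : ∀ G ∈ Ω.powerset, ‖v G‖ ≤ 2 * (2 * α) ^ G.card := by
    intro G hG
    have hGr : G ⊆ Finset.range h := (Finset.mem_powerset.1 hG).trans (Finset.filter_subset _ _)
    have hp := norm_patternWord_le hw hy h G
    rw [Finset.inter_eq_left.2 hGr] at hp
    rw [hv, norm_smul, norm_mul, norm_pow, norm_neg, norm_one, one_pow, one_mul,
      Real.norm_of_nonneg (by positivity)]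
    have hb : ‖w ^ s * y * patternWord w y h G * w ^ (n - h - M - s)‖ ≤ 1 * 2 * 2 ^ G.card * 1 := by
      refine (norm_mul_le _ _).trans (mul_le_mul ?_ (hpow _) (norm_nonneg _) (by positivity))
      refine (norm_mul_le _ _).trans (mul_le_mul ?_ hp (norm_nonneg _) (by positivity))
      exact (norm_mul_le _ _).trans (mul_le_mul (hpow _) hy (norm_nonneg _) (by positivity))
    calc α ^ G.card * _ ≤ α ^ G.card * (1 * 2 * 2 ^ G.card * 1) :=
          mul_le_mul_of_nonneg_left hb (by positivity)
      _ = 2 * (2 * α) ^ G.card := by rw [mul_pow]; ring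
  rw [e]
  refine (norm_sum_le _ _).trans ?_
  have hC : Real.exp (2 * α * ∑ a ∈ Finset.range (⌊√(n : ℝ) / 8⌋₊ + 1),
      (√(n : ℝ) / 8) ^ a / a.factorial * (2 * √a / √n) ^ a) ≤ Real.exp (4 * α) := by
    refine Real.exp_le_exp.2 ?_
    have := sum_fairBin_egf_le hn (⌊√(n : ℝ) / 8⌋₊ + 1)
    nlinarith
  have hdiff := sum_half_seqDiff_patternWeight_le (w := 2 * α) (by positivity)
    (b := fairBin n) (β := fun a => (2 * √a / √n) ^ a)
    (fun s c Ω => sum_abs_seqDiff_fairBin_le hn s c Ω)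
    (m := ⌊√(n : ℝ) / 8⌋₊) (Nat.floor_le (by positivity)) hC Ω
  have key := sum_norm_altAvg_le hδ0 hδ1 hz Ω.powerset v
    (fun d G x => (1 / 2) ^ d * seqDiff^[d] (patternWeight (fairBin n) G) x)
    (fun d G x => by rw [seqDiff_iterate_succ, pow_succ]; ring)
    (C := 2 * Real.exp (4 * α)) (η := (1 / 2) ^ ⌊√(n : ℝ) / 8⌋₊) (fun d x => by
      rw [mul_assoc]
      refine le_trans ?_ (mul_le_mul_of_nonneg_left (hdiff d x) (by norm_num))
      rw [Finset.mul_sum]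
      refine Finset.sum_le_sum fun G hG => ?_
      rw [← mul_assoc]
      exact mul_le_mul_of_nonneg_right (hvn G hG) (abs_nonneg _)) M 0 s
  simpa using key

/-- The three errors are: frozen coins `s > s₀`, for which the window need not fit; the cut after
`h` positions; and the smoothed average over the `M` active coins. -/
theorem norm_orderedProd_parityString_sub_le [NormOneClass R] (hδ0 : 0 ≤ δ) (hδ1 : δ ≤ 1) (hz : ‖z‖ ≤ 1)
    (ho : ‖o‖ ≤ 1) {n h M s₀ : ℕ} (hn : 0 < n) (hs : s₀ + M + h = n) {α : ℝ} (hα : 0 ≤ α)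
    (hα1 : ∀ i, α * fairBin n i ≤ 1) :
    ‖orderedProd (fun i => zeroTrace δ z + parityString n α 0 i • oneExcess δ z o) 0 (n + 1) -
      orderedProd (fun i => zeroTrace δ z + parityString n α 1 i • oneExcess δ z o) 0 (n + 1)‖ ≤
    α * (2 * (1 / 2) ^ s₀ * (3 / 2) ^ (s₀ + h) + 4 * α * (1 / 2) ^ h * (9 / 8) ^ n +
      2 * Real.exp (4 * α) * ((1 / 2) ^ ⌊√(n : ℝ) / 8⌋₊ + (1 - δ / 2) ^ M)) := by
  have hw := norm_zeroTrace_le (R := R) hδ0 hδ1 hz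
  have hy := norm_oneExcess_le (R := R) hδ0 hδ1 hz ho
  have hbit : ∀ r i, ‖zeroTrace δ z + parityString n α r i • oneExcess δ z o‖ ≤ 1 := fun r i =>
    norm_bitTrace_le hδ0 hδ1 hz ho (parityString_nonneg hα _ _)
      ((parityString_le hα _ _).trans (hα1 i))
  have hmain := fun s (hs' : s + M + h ≤ n) =>
    norm_windowed_average_le (R := R) hδ0 hδ1 hz ho hn hs' hα
  rw [orderedProd_parityString_sub, norm_smul, Real.norm_of_nonneg hα]
  refine mul_le_mul_of_nonneg_left ?_ hα
  set w := zeroTrace δ z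
  set y := oneExcess δ z o
  have hpow : ∀ a, ‖w ^ a‖ ≤ 1 := fun a => (norm_pow_le _ _).trans (pow_le_one₀ (norm_nonneg _) hw)
  set X : ℕ → R := fun j => (-1 : ℝ) ^ j • (w ^ j * y *
      orderedProd (fun i => w + parityString n α j i • y) (j + 1) (n - j)) with hX
  set X' : ℕ → R := fun j => (-1 : ℝ) ^ j • (w ^ j * y *
      (orderedProd (fun x => w + parityString n α j x • y) (j + 1) h * w ^ (n - h - j))) with hX'
  set K := 2 * Real.exp (4 * α) * ((1 / 2) ^ ⌊√(n : ℝ) / 8⌋₊ + (1 - δ / 2) ^ M) with hK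
  have hK0 : 0 ≤ K := by
    have : 0 ≤ 1 - δ / 2 := by linarith
    positivity
  have hwy : ∀ j, ‖w ^ j * y‖ ≤ 2 := fun j =>
    (norm_mul_le _ _).trans ((mul_le_of_le_one_left (norm_nonneg _) (hpow j)).trans hy)
  have hXn : ∀ j, ‖X j‖ ≤ 2 := by
    intro j
    rw [hX, norm_smul, norm_pow, norm_neg, norm_one, one_pow, one_mul]
    refine (norm_mul_le _ _).trans ?_
    exact (mul_le_of_le_one_right (norm_nonneg _) (norm_orderedProd_le_one (hbit j) _ _)).trans
      (hwy j)
  -- Cutting costs at most the binomial mass beyond `j + h`. The bound is kept geometric in `j` so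
  -- that its binomial average is explicit.
  set e : ℕ → ℝ := fun j => 4 * α * (1 / 2) ^ h * (3 / 2) ^ n * (1 / 2) ^ j with he
  have he0 : ∀ j, 0 ≤ e j := fun j => by positivity
  have hXX' : ∀ j, j + h ≤ n → ‖X j - X' j‖ ≤ e j := by
    intro j hj
    have e1 : n - j = h + (n - h - j) := by omega
    have e2 : X j - X' j = (-1 : ℝ) ^ j • (w ^ j * y *
        (orderedProd (fun x => w + parityString n α j x • y) (j + 1) h *
          (orderedProd (fun x => w + parityString n α j x • y) (j + 1 + h) (n - h - j) -
            orderedProd (fun _ => w) (j + 1 + h) (n - h - j)))) := by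
      have e3 : orderedProd (fun x => w + parityString n α j x • y) (j + 1) (n - j) =
          orderedProd (fun x => w + parityString n α j x • y) (j + 1) h *
            orderedProd (fun x => w + parityString n α j x • y) (j + 1 + h) (n - h - j) := by
        rw [← orderedProd_add, ← e1]
      simp only [hX, hX']
      rw [e3, orderedProd_const, ← smul_sub, ← mul_sub, ← mul_sub]
    rw [e2, norm_smul, norm_pow, norm_neg, norm_one, one_pow, one_mul]
    refine (norm_mul_le _ _).trans ?_
    have h1 : ‖orderedProd (fun x => w + parityString n α j x • y) (j + 1) h *
          (orderedProd (fun x => w + parityString n α j x • y) (j + 1 + h) (n - h - j) -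
            orderedProd (fun _ => w) (j + 1 + h) (n - h - j))‖ ≤
        α * 2 * ((1 / 2) ^ (j + 1 + h) * (3 / 2) ^ n) := by
      refine (norm_mul_le _ _).trans ?_
      refine (mul_le_of_le_one_left (norm_nonneg _)
        (norm_orderedProd_le_one (hbit j) _ _)).trans ?_
      refine (norm_orderedProd_sub_le (hbit j) (fun _ => hw) _ _).trans ?_
      refine le_trans ?_ (mul_le_mul_of_nonneg_left (sum_range_fairBin_tail_le
        (n := n) (a := j + 1 + h) (m := n - h - j) (by omega)) (by positivity))
      rw [Finset.mul_sum]
      refine Finset.sum_le_sum fun i _ => ?_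
      rw [add_sub_cancel_left, norm_smul, Real.norm_of_nonneg (parityString_nonneg hα _ _)]
      calc _ ≤ (α * fairBin n (j + 1 + h + i)) * 2 :=
            mul_le_mul (parityString_le hα _ _) hy (norm_nonneg _)
              (mul_nonneg hα (fairBin_nonneg _ _))
        _ = _ := by ring
    refine (mul_le_mul (hwy j) h1 (norm_nonneg _) (by norm_num)).trans ?_
    rw [he]
    have e3 : 2 * (α * 2 * ((1 / 2 : ℝ) ^ (j + 1 + h) * (3 / 2) ^ n)) =
        1 / 2 * (4 * α * (1 / 2) ^ h * (3 / 2) ^ n * (1 / 2) ^ j) := by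
      rw [pow_add, pow_succ]; ring
    rw [e3]
    have := he0 j
    simp only [he] at this
    linarith
  have hblock : ∀ s, ‖binAvg M fun i => X (s + i)‖ ≤
      2 * (1 / 2) ^ s₀ * 2 ^ s + (binAvg M fun i => e (s + i)) + K := by
    intro s
    have hav : 0 ≤ binAvg M fun i => e (s + i) :=
      Finset.sum_nonneg fun i _ => mul_nonneg (fairBin_nonneg _ _) (he0 _)
    -- For `s > s₀` the trivial bound `2` is inflated by `2 ^ s / 2 ^ s₀ ≥ 1`, whose average over
    -- `s₀ + h` coins is computable.
    rcases Nat.lt_or_ge s₀ s with hlt | hle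
    · have h1 : ‖binAvg M fun i => X (s + i)‖ ≤ 2 :=
        (norm_binAvg_le _ _).trans ((binAvg_mono fun i _ => hXn _).trans
          (le_of_eq (binAvg_const M (2 : ℝ))))
      have h2 : (1 : ℝ) ≤ (1 / 2) ^ s₀ * 2 ^ s := by
        rw [one_div, inv_pow, inv_mul_eq_div, one_le_div (by positivity)]
        exact pow_le_pow_right₀ (by norm_num) hlt.le
      nlinarith
    · have h1 : ‖binAvg M fun i => X' (s + i)‖ ≤ K := hmain s (by omega)
      have h2 : ‖binAvg M fun i => X (s + i) - X' (s + i)‖ ≤ binAvg M fun i => e (s + i) :=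
        (norm_binAvg_le _ _).trans (binAvg_mono fun i hi => hXX' _ (by omega))
      rw [binAvg_sub_fun] at h2
      have h3 := norm_add_le ((binAvg M fun i => X (s + i)) - binAvg M fun i => X' (s + i))
        (binAvg M fun i => X' (s + i))
      rw [sub_add_cancel] at h3
      have h4 : (0 : ℝ) ≤ 2 * (1 / 2) ^ s₀ * 2 ^ s := by positivity
      linarith
  have hnk : n = (s₀ + h) + M := by omega
  have hsplit : binAvg n X = binAvg (s₀ + h) fun s => binAvg M fun i => X (s + i) := by
    rw [← binAvg_add, ← hnk]
  have hsplit_e : (binAvg (s₀ + h) fun s => binAvg M fun i => e (s + i)) = binAvg n e := by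
    rw [← binAvg_add, ← hnk]
  have htot : binAvg n e = 4 * α * (1 / 2) ^ h * (9 / 8) ^ n := by
    rw [he, binAvg_mul_left, binAvg_pow, mul_assoc, ← mul_pow]
    norm_num
  rw [hsplit]
  refine (norm_binAvg_le _ _).trans ((binAvg_mono fun s _ => hblock s).trans (le_of_eq ?_))
  rw [binAvg_add_fun, binAvg_add_fun, hsplit_e, htot, binAvg_const, binAvg_mul_left, binAvg_pow]
  norm_num

end ParityStrings

/-! ### From total variation to tests on many samples. -/

section Testing

variable {X : Type}

theorem tsum_mul_le_one (P : PMF X) {φ : X → ENNReal} (hφ : ∀ x, φ x ≤ 1) :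
    ∑' x, P x * φ x ≤ 1 :=
  (ENNReal.tsum_le_tsum fun x => mul_le_of_le_one_right' (hφ x)).trans P.tsum_coe.le

theorem summable_toReal_pmf (P : PMF X) : Summable fun x => (P x).toReal :=
  ENNReal.summable_toReal P.tsum_coe_ne_top

theorem tsum_toReal_pmf (P : PMF X) : ∑' x, (P x).toReal = 1 := by
  rw [← ENNReal.tsum_toReal_eq P.apply_ne_top, P.tsum_coe, ENNReal.toReal_one]

theorem toReal_tsum_mul (P : PMF X) {φ : X → ENNReal} (hφ : ∀ x, φ x ≤ 1) :
    (∑' x, P x * φ x).toReal = ∑' x, (P x).toReal * (φ x).toReal := by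
  rw [ENNReal.tsum_toReal_eq fun x =>
    ENNReal.mul_ne_top (P.apply_ne_top x) (ne_top_of_le_ne_top ENNReal.one_ne_top (hφ x))]
  simp_rw [ENNReal.toReal_mul]

theorem toReal_le_one_of_le_one {x : ENNReal} (h : x ≤ 1) : x.toReal ≤ 1 := by
  simpa using ENNReal.toReal_mono ENNReal.one_ne_top h

theorem summable_toReal_mul (P : PMF X) {φ : X → ENNReal} (hφ : ∀ x, φ x ≤ 1) :
    Summable fun x => (P x).toReal * (φ x).toReal :=
  (summable_toReal_pmf P).of_nonneg_of_le (fun _ => by positivity) fun x =>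
    mul_le_of_le_one_right ENNReal.toReal_nonneg (toReal_le_one_of_le_one (hφ x))

theorem abs_test_sub_le (P Q : PMF X) {φ : X → ENNReal} (hφ : ∀ x, φ x ≤ 1) :
    |(∑' x, P x * φ x).toReal - (∑' x, Q x * φ x).toReal| ≤ 2 * tvDist P Q := by
  rw [toReal_tsum_mul P hφ, toReal_tsum_mul Q hφ,
    ← (summable_toReal_mul P hφ).tsum_sub (summable_toReal_mul Q hφ), tvDist, ← mul_assoc]
  norm_num
  have hs : Summable fun x => |(P x).toReal - (Q x).toReal| :=
    ((summable_toReal_pmf P).sub (summable_toReal_pmf Q)).abs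
  have hle : ∀ x, ‖(P x).toReal * (φ x).toReal - (Q x).toReal * (φ x).toReal‖ ≤
      |(P x).toReal - (Q x).toReal| := by
    intro x
    rw [← sub_mul, Real.norm_eq_abs, abs_mul, abs_of_nonneg (a := (φ x).toReal)
      ENNReal.toReal_nonneg]
    exact mul_le_of_le_one_right (abs_nonneg _) (toReal_le_one_of_le_one (hφ x))
  rw [← Real.norm_eq_abs]
  exact tsum_of_norm_bounded hs.hasSum hle

theorem abs_test_sub_le_of_abs_sub_le (Q : PMF X) {φ ψ : X → ENNReal} (hφ : ∀ x, φ x ≤ 1)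
    (hψ : ∀ x, ψ x ≤ 1) {r : ℝ} (h : ∀ x, |(φ x).toReal - (ψ x).toReal| ≤ r) :
    |(∑' x, Q x * φ x).toReal - (∑' x, Q x * ψ x).toReal| ≤ r := by
  rw [toReal_tsum_mul Q hφ, toReal_tsum_mul Q hψ,
    ← (summable_toReal_mul Q hφ).tsum_sub (summable_toReal_mul Q hψ)]
  have hs : HasSum (fun x => (Q x).toReal * r) (1 * r) := by
    rw [← tsum_toReal_pmf Q]
    exact (summable_toReal_pmf Q).hasSum.mul_right r
  rw [one_mul] at hs
  rw [← Real.norm_eq_abs]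
  refine tsum_of_norm_bounded hs fun x => ?_
  rw [← mul_sub, Real.norm_eq_abs, abs_mul, abs_of_nonneg ENNReal.toReal_nonneg]
  exact mul_le_mul_of_nonneg_left (h x) ENNReal.toReal_nonneg

theorem tsum_bind_mul {Y : Type} (P : PMF X) (f : X → PMF Y) (φ : Y → ENNReal) :
    ∑' y, (P.bind f) y * φ y = ∑' x, P x * ∑' y, f x y * φ y := by
  simp_rw [PMF.bind_apply, ← ENNReal.tsum_mul_right, ← ENNReal.tsum_mul_left]
  rw [ENNReal.tsum_comm]
  simp_rw [mul_assoc]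

theorem tsum_pure_mul (a : X) (φ : X → ENNReal) : ∑' x, PMF.pure a x * φ x = φ a := by
  rw [tsum_eq_single a]
  · simp
  · intro x hx
    simp [hx]

theorem tsum_iidSamples_succ (P : PMF X) (t : ℕ) (φ : List X → ENNReal) :
    ∑' l, iidSamples P (t + 1) l * φ l =
      ∑' x, P x * ∑' l, iidSamples P t l * φ (x :: l) := by
  rw [iidSamples, tsum_bind_mul]
  simp_rw [tsum_bind_mul, tsum_pure_mul]

/-- Hybrid argument: samples are replaced one at a time, and averaging over the other samples leaves
a test on a single one. -/
theorem abs_iid_test_sub_le (P Q : PMF X) (t : ℕ) {φ : List X → ENNReal} (hφ : ∀ l, φ l ≤ 1) :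
    |(∑' l, iidSamples P t l * φ l).toReal - (∑' l, iidSamples Q t l * φ l).toReal| ≤
      t * (2 * tvDist P Q) := by
  induction t generalizing φ with
  | zero => simp [iidSamples]
  | succ t ih =>
    rw [tsum_iidSamples_succ, tsum_iidSamples_succ]
    have h1 : ∀ x, ∑' l, iidSamples P t l * φ (x :: l) ≤ 1 := fun x =>
      tsum_mul_le_one _ fun l => hφ _
    have h2 : ∀ x, ∑' l, iidSamples Q t l * φ (x :: l) ≤ 1 := fun x =>
      tsum_mul_le_one _ fun l => hφ _
    have h3 := abs_test_sub_le P Q h1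
    have h4 := abs_test_sub_le_of_abs_sub_le Q h1 h2 fun x => ih fun l => hφ (x :: l)
    refine (abs_sub_le _ _ _).trans ((add_le_add h3 h4).trans (le_of_eq ?_))
    push_cast; ring

theorem two_tests_le (P Q : PMF X) (t : ℕ) {φ ψ : List X → ENNReal}
    (h : ∀ l, φ l + ψ l ≤ 1) :
    (∑' l, iidSamples P t l * φ l).toReal + (∑' l, iidSamples Q t l * ψ l).toReal ≤
      1 + t * (2 * tvDist P Q) := by
  have hφ : ∀ l, φ l ≤ 1 := fun l => le_self_add.trans (h l)
  have hψ : ∀ l, ψ l ≤ 1 := fun l => le_add_self.trans (h l)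
  have h1 := (abs_le.1 (abs_iid_test_sub_le P Q t hφ)).2
  have h2 : (∑' l, iidSamples Q t l * φ l).toReal + (∑' l, iidSamples Q t l * ψ l).toReal ≤ 1 := by
    rw [← ENNReal.toReal_add
      (ne_top_of_le_ne_top ENNReal.one_ne_top (tsum_mul_le_one _ hφ))
      (ne_top_of_le_ne_top ENNReal.one_ne_top (tsum_mul_le_one _ hψ)), ← ENNReal.tsum_add]
    simp_rw [← mul_add]
    exact toReal_le_one_of_le_one (tsum_mul_le_one _ h)
  linarith

theorem guessProb_le (δ : unitInterval) {m : ℕ} (S T : ProbString m) (t : ℕ)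
    (A : Distinguisher) :
    guessProb δ S T t A ≤ 1 / 2 + t * tvDist (traceLaw δ S) (traceLaw δ T) := by
  have h := two_tests_le (traceLaw δ S) (traceLaw δ T) t (φ := fun l => A l true)
    (ψ := fun l => A l false) fun l => by
      have h := (A l).tsum_coe
      rw [tsum_fintype, Fintype.sum_bool] at h
      exact h.le
  rw [guessProb, PMF.bind_apply, PMF.bind_apply]
  linarith

theorem successProb_add_le (δ : unitInterval) {m : ℕ} (S T : ProbString m) (t : ℕ)
    (A : Estimator m) {G H : Set (Fin m → ℝ)} (hGH : Disjoint G H) (hH : MeasurableSet H) :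
    successProb δ S t A G + successProb δ T t A H ≤
      1 + t * (2 * tvDist (traceLaw δ S) (traceLaw δ T)) := by
  refine two_tests_le _ _ t fun l => ?_
  rw [← measure_union hGH hH]
  exact prob_le_one

end Testing

/-! ### The size of the largest binomial probability. -/

section CentralBinomial

/-- The induction step amounts to `(2k + 1)(2k + 3) ≤ 4(k + 1)²`. -/
theorem sq_centralBinom_mul_le (k : ℕ) :
    (k.centralBinom : ℝ) ^ 2 * (2 * k + 1) ≤ 16 ^ k := by
  induction k with
  | zero => simp
  | succ k ih =>
    have h : ((k : ℝ) + 1) * (k + 1).centralBinom = 2 * (2 * k + 1) * k.centralBinom := by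
      exact_mod_cast Nat.succ_mul_centralBinom_succ k
    have hk : (0 : ℝ) < ((k : ℝ) + 1) ^ 2 := by positivity
    refine le_of_mul_le_mul_left ?_ hk
    calc ((k : ℝ) + 1) ^ 2 * (((k + 1).centralBinom : ℝ) ^ 2 * (2 * (k + 1 : ℕ) + 1))
        = (((k : ℝ) + 1) * (k + 1).centralBinom) ^ 2 * (2 * k + 3) := by push_cast; ring
      _ = (k.centralBinom : ℝ) ^ 2 * (2 * k + 1) * (4 * (2 * k + 1) * (2 * k + 3)) := by
          rw [h]; ring
      _ ≤ 16 ^ k * (4 * (2 * k + 1) * (2 * k + 3)) :=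
          mul_le_mul_of_nonneg_right ih (by positivity)
      _ ≤ 16 ^ k * (16 * ((k : ℝ) + 1) ^ 2) :=
          mul_le_mul_of_nonneg_left (by nlinarith) (by positivity)
      _ = ((k : ℝ) + 1) ^ 2 * 16 ^ (k + 1) := by ring

/-- The induction step amounts to `4(k + 1)(k + 2) ≤ (2k + 3)²`. -/
theorem le_sq_centralBinom_mul (k : ℕ) :
    (16 : ℝ) ^ (k + 1) ≤ ((k + 1).centralBinom : ℝ) ^ 2 * (4 * (k + 1)) := by
  induction k with
  | zero => norm_num [Nat.centralBinom, Nat.choose]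
  | succ k ih =>
    have h : ((k : ℝ) + 2) * (k + 2).centralBinom = 2 * (2 * k + 3) * (k + 1).centralBinom := by
      have := Nat.succ_mul_centralBinom_succ (k + 1)
      have h' : ((k + 1 + 1 : ℕ) : ℝ) * ((k + 1 + 1).centralBinom : ℕ) =
        ((2 * (2 * (k + 1) + 1) : ℕ) : ℝ) * ((k + 1).centralBinom : ℕ) := by exact_mod_cast this
      push_cast at h'
      linarith
    have hk : (0 : ℝ) < ((k : ℝ) + 2) * (k + 1) := by positivity
    refine le_of_mul_le_mul_left ?_ hk
    calc ((k : ℝ) + 2) * (k + 1) * 16 ^ (k + 1 + 1)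
        = 16 ^ (k + 1) * (16 * (k + 1) * (k + 2)) := by ring
      _ ≤ ((k + 1).centralBinom : ℝ) ^ 2 * (4 * (k + 1)) * (16 * (k + 1) * (k + 2)) :=
          mul_le_mul_of_nonneg_right ih (by positivity)
      _ = (16 * (k + 1) * (k + 2)) * (4 * (k + 1)) * ((k + 1).centralBinom : ℝ) ^ 2 := by ring
      _ ≤ (4 * (2 * k + 3) ^ 2) * (4 * (k + 1)) * ((k + 1).centralBinom : ℝ) ^ 2 := by
          refine mul_le_mul_of_nonneg_right (mul_le_mul_of_nonneg_right ?_ (by positivity))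
            (by positivity)
          nlinarith
      _ = (2 * (2 * k + 3) * ((k + 1).centralBinom : ℝ)) ^ 2 * (4 * (k + 1)) := by ring
      _ = ((k : ℝ) + 2) * (k + 1) * (((k + 1 + 1).centralBinom : ℝ) ^ 2 *
            (4 * ((k + 1 : ℕ) + 1))) := by
          rw [← h]; push_cast; ring

theorem fairBin_middle (m : ℕ) :
    fairBin (2 * m + 1) m = (m + 1).centralBinom / 4 ^ (m + 1) := by
  have h : (m + 1).centralBinom = 2 * (2 * m + 1).choose m := by
    rw [Nat.centralBinom_eq_two_mul_choose, show 2 * (m + 1) = 2 * m + 1 + 1 by ring,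
      Nat.choose_succ_succ, Nat.succ_eq_add_one, Nat.choose_symm_half]
    ring
  rw [fairBin, h, show (4 : ℝ) ^ (m + 1) = 2 * 2 ^ (2 * m + 1) by
    rw [show (4 : ℝ) = 2 ^ 2 by norm_num, ← pow_mul]; ring]
  push_cast
  field_simp

theorem fairBin_le {n : ℕ} (hn : Odd n) (i : ℕ) : fairBin n i ≤ 1 / √(n : ℝ) := by
  obtain ⟨m, rfl⟩ := hn
  have h1 : fairBin (2 * m + 1) i ≤ fairBin (2 * m + 1) m := by
    have := Nat.choose_le_middle i (2 * m + 1)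
    rw [show (2 * m + 1) / 2 = m by omega] at this
    unfold fairBin
    gcongr
  refine h1.trans ?_
  rw [fairBin_middle, div_le_div_iff₀ (by positivity) (by positivity), one_mul]
  refine abs_le_of_sq_le_sq' ?_ (by positivity) |>.2
  have h := sq_centralBinom_mul_le (m + 1)
  rw [mul_pow, Real.sq_sqrt (Nat.cast_nonneg _), ← pow_mul, mul_comm (m + 1) 2, pow_mul]
  norm_num at *
  refine le_trans (mul_le_mul_of_nonneg_left ?_ (by positivity)) h
  linarith

theorem le_fairBin_middle (m : ℕ) :
    1 / 2 * (1 / √((2 * m + 1 : ℕ) : ℝ)) ≤ fairBin (2 * m + 1) m := by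
  have hs : (0 : ℝ) < √((2 * m + 1 : ℕ) : ℝ) := Real.sqrt_pos.2 (by positivity)
  rw [fairBin_middle, div_mul_div_comm, one_mul, div_le_div_iff₀ (by positivity) (by positivity),
    one_mul]
  refine abs_le_of_sq_le_sq' ?_ (by positivity) |>.2
  have h := le_sq_centralBinom_mul m
  rw [mul_pow, mul_pow, Real.sq_sqrt (Nat.cast_nonneg _), ← pow_mul, mul_comm (m + 1) 2, pow_mul]
  norm_num at *
  refine h.trans (mul_le_mul_of_nonneg_left ?_ (by positivity))
  have : (0 : ℝ) ≤ m := Nat.cast_nonneg m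
  linarith

end CentralBinomial

/-! ### Choice of parameters, distances and sample lower bounds. -/

section Main

theorem bin_half_eq_fairBin (n i : ℕ) : bin n (1 / 2) i = fairBin n i := by
  rcases Nat.lt_or_ge n i with h | h
  · rw [fairBin_eq_zero h, bin, Nat.choose_eq_zero_of_lt h]; simp
  · rw [bin, fairBin, show (1 : ℝ) - 1 / 2 = 1 / 2 by norm_num, mul_assoc, ← pow_add,
      Nat.add_sub_cancel' h, one_div, inv_pow, div_eq_mul_inv]

theorem evenString_eq (n : ℕ) (α : ℝ) (i : Fin (n + 1)) :
    evenString n α i = parityString n α 0 i := by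
  simp only [evenString, parityString, bin_half_eq_fairBin, Nat.even_iff, Nat.zero_mod]

theorem oddString_eq (n : ℕ) (α : ℝ) (i : Fin (n + 1)) :
    oddString n α i = parityString n α 1 i := by
  simp only [oddString, parityString, bin_half_eq_fairBin, Nat.odd_iff, Nat.one_mod]

theorem traceElem_toProbString {n : ℕ} (δ : ℝ) {f : Fin (n + 1) → ℝ} {p : ℕ → ℝ}
    (hf : ∀ i, f i ∈ Set.Icc (0 : ℝ) 1) (hp : ∀ i : Fin (n + 1), f i = p i) :
    traceElem δ (List.ofFn (toProbString f hf)) = orderedProd (fun i =>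
      zeroTrace δ (letter false) + p i • oneExcess δ (letter false) (letter true)) 0 (n + 1) := by
  rw [traceElem, List.map_ofFn, ← prod_ofFn_eq_orderedProd]
  congr 2
  funext i
  simp [toProbString, hp]

theorem tvDist_traceLaw_le {n h M s₀ : ℕ} (hn : 0 < n) (hs : s₀ + M + h = n) {α : ℝ}
    (hα : 0 ≤ α) (hα1 : ∀ i, α * fairBin n i ≤ 1) (δ : unitInterval)
    (he : ∀ i, evenString n α i ∈ Set.Icc (0 : ℝ) 1)
    (ho : ∀ i, oddString n α i ∈ Set.Icc (0 : ℝ) 1) :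
    tvDist (traceLaw δ (toProbString (evenString n α) he))
      (traceLaw δ (toProbString (oddString n α) ho)) ≤ 1 / 2 *
    (α * (2 * (1 / 2) ^ s₀ * (3 / 2) ^ (s₀ + h) + 4 * α * (1 / 2) ^ h * (9 / 8) ^ n +
      2 * Real.exp (4 * α) * ((1 / 2) ^ ⌊√(n : ℝ) / 8⌋₊ + (1 - (δ : ℝ) / 2) ^ M))) := by
  rw [tvDist, (hasSum_abs_sub_traceLaw δ _ _).tsum_eq,
    traceElem_toProbString _ he (evenString_eq n α), traceElem_toProbString _ ho (oddString_eq n α)]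
  refine mul_le_mul_of_nonneg_left ?_ (by norm_num)
  have hl : ∀ b, ‖letter b‖ ≤ 1 := fun b => by rw [letter, l1_norm_single]; simp
  exact norm_orderedProd_parityString_sub_le δ.2.1 δ.2.2 (hl _) (hl _) hn hs hα hα1

theorem pow_le_exp_neg_div {r : ℝ} (h0 : 0 ≤ r) {a : ℝ} (h : r ≤ 1 - a) (m : ℕ) :
    r ^ m ≤ Real.exp (-(a * m)) := by
  have h1 : r ≤ Real.exp (-a) := by linarith [Real.add_one_le_exp (-a)]
  calc r ^ m ≤ Real.exp (-a) ^ m := pow_le_pow_left₀ h0 h1 m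
    _ = Real.exp (-(a * m)) := by rw [← Real.exp_nat_mul]; congr 1; ring

theorem trace_bound_le_exp {n : ℕ} {x α δ : ℝ} (hx : x = √(n : ℝ)) (hx256 : 256 ≤ x)
    (hα : 0 ≤ α) (hαx : α ≤ 1 / 256 * x) (hδ : 256 / x ≤ δ) (hδ1 : δ ≤ 1) {m : ℕ}
    (hm : m = n / 8) {s₀ : ℕ} (hs : s₀ + m + 2 * m = n) :
    α * (2 * (1 / 2) ^ s₀ * (3 / 2) ^ (s₀ + 2 * m) + 4 * α * (1 / 2) ^ (2 * m) * (9 / 8) ^ n +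
      2 * Real.exp (4 * α) * ((1 / 2) ^ ⌊x / 8⌋₊ + (1 - δ / 2) ^ m)) ≤
    2 * Real.exp (-(1 / 256 * x)) := by
  have hx0 : 0 < x := by linarith
  have hxn : x ^ 2 = n := by rw [hx, Real.sq_sqrt (Nat.cast_nonneg n)]
  have hmn : (n : ℝ) ≤ 8 * m + 7 := by
    have : n ≤ 8 * m + 7 := by omega
    exact_mod_cast this
  have hmx : x ^ 2 / 16 ≤ m := by nlinarith
  have hdecay : Real.exp (-(1 / 3 * (m : ℝ))) ≤ Real.exp (-x) := by
    apply Real.exp_le_exp.2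
    nlinarith
  -- As `s₀ ≥ 5 * m`, the base per unit of `m` is `(3/4)⁵ · 9/4 < 2/3`. For the next term it is
  -- `(9/8)⁸ / 4 < 2/3`.
  have t1 : 2 * (1 / 2 : ℝ) ^ s₀ * (3 / 2) ^ (s₀ + 2 * m) ≤ 2 * Real.exp (-x) := by
    have h5 : 5 * m ≤ s₀ := by omega
    have e : (1 / 2 : ℝ) ^ s₀ * (3 / 2) ^ (s₀ + 2 * m) = (3 / 4) ^ s₀ * (9 / 4) ^ m := by
      rw [pow_add, ← mul_assoc, ← mul_pow, pow_mul]; norm_num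
    rw [mul_assoc, e]
    refine mul_le_mul_of_nonneg_left ?_ (by norm_num)
    calc (3 / 4 : ℝ) ^ s₀ * (9 / 4) ^ m ≤ (3 / 4) ^ (5 * m) * (9 / 4) ^ m :=
          mul_le_mul_of_nonneg_right (pow_le_pow_of_le_one (by norm_num) (by norm_num) h5)
            (by positivity)
      _ = (2187 / 4096) ^ m := by rw [pow_mul, ← mul_pow]; norm_num
      _ ≤ Real.exp (-(1 / 3 * m)) := pow_le_exp_neg_div (by norm_num) (by norm_num) m
      _ ≤ _ := hdecay
  have t2 : 4 * α * (1 / 2) ^ (2 * m) * (9 / 8) ^ n ≤ 4 * α * (3 * Real.exp (-x)) := by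
    rw [mul_assoc (4 * α)]
    refine mul_le_mul_of_nonneg_left ?_ (by positivity)
    calc (1 / 2 : ℝ) ^ (2 * m) * (9 / 8) ^ n ≤ (1 / 2) ^ (2 * m) * (9 / 8) ^ (8 * m + 7) :=
          mul_le_mul_of_nonneg_left (pow_le_pow_right₀ (by norm_num) (by omega)) (by positivity)
      _ = (43046721 / 67108864) ^ m * (9 / 8) ^ 7 := by
          rw [pow_add, pow_mul, pow_mul, ← mul_assoc, ← mul_pow]; norm_num
      _ ≤ Real.exp (-(1 / 3 * m)) * 3 :=
          mul_le_mul (pow_le_exp_neg_div (by norm_num) (by norm_num) m) (by norm_num)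
            (by positivity) (Real.exp_pos _).le
      _ ≤ 3 * Real.exp (-x) := by linarith
  have t3 : (1 / 2 : ℝ) ^ ⌊x / 8⌋₊ ≤ 2 * Real.exp (-(x / 16)) := by
    have hfl := Nat.lt_floor_add_one (x / 8)
    calc (1 / 2 : ℝ) ^ ⌊x / 8⌋₊ = 2 * (1 / 2) ^ (⌊x / 8⌋₊ + 1) := by rw [pow_succ]; ring
      _ ≤ 2 * Real.exp (-(1 / 2 * (⌊x / 8⌋₊ + 1 : ℕ))) :=
          mul_le_mul_of_nonneg_left (pow_le_exp_neg_div (by norm_num) (by norm_num) _)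
            (by norm_num)
      _ ≤ 2 * Real.exp (-(x / 16)) := by
          refine mul_le_mul_of_nonneg_left (Real.exp_le_exp.2 ?_) (by norm_num)
          push_cast; linarith
  have t4 : (1 - δ / 2) ^ m ≤ Real.exp (-(x / 16)) := by
    refine (pow_le_exp_neg_div (by linarith) (le_refl (1 - δ / 2)) m).trans
      (Real.exp_le_exp.2 (neg_le_neg ?_))
    have h1 : 256 / x / 2 * (x ^ 2 / 16) ≤ δ / 2 * m :=
      mul_le_mul (by linarith) hmx (by positivity)
        (by have : 0 < 256 / x := by positivity
            linarith)
    have h2 : 256 / x / 2 * (x ^ 2 / 16) = 8 * x := by field_simp; norm_num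
    linarith
  have hE : Real.exp (4 * α) ≤ Real.exp (x / 64) := Real.exp_le_exp.2 (by linarith)
  have hαe : α ≤ Real.exp (x / 256) := by linarith [Real.add_one_le_exp (x / 256)]
  -- All exponentials become powers of `u`: the bracket is at most `20 / u ^ 12`, the prefactor `α`
  -- at most `u`, and `u ^ 10 ≥ 11` disposes of the constant.
  set u := Real.exp (x / 256) with hu
  have hu1 : 1 ≤ u := Real.one_le_exp (by positivity)
  have hu10 : 11 ≤ u ^ 10 := by
    rw [hu, ← Real.exp_nat_mul]
    have := Real.add_one_le_exp (((10 : ℕ) : ℝ) * (x / 256))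
    push_cast at *
    linarith
  have hu0 : 0 < u := Real.exp_pos _
  have e64 : Real.exp (x / 64) = u ^ 4 := by rw [hu, ← Real.exp_nat_mul]; congr 1; push_cast; ring
  have e16 : Real.exp (-(x / 16)) = (u ^ 16)⁻¹ := by
    rw [hu, ← Real.exp_nat_mul, ← Real.exp_neg]; congr 1; push_cast; ring
  have e1 : Real.exp (-x) = (u ^ 256)⁻¹ := by
    rw [hu, ← Real.exp_nat_mul, ← Real.exp_neg]; congr 1; push_cast; ring
  have e256 : Real.exp (-(1 / 256 * x)) = u⁻¹ := by
    rw [hu, ← Real.exp_neg]; congr 1; ring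
  have h256 : (u ^ 256)⁻¹ ≤ (u ^ 13)⁻¹ :=
    inv_anti₀ (by positivity) (pow_le_pow_right₀ hu1 (by norm_num))
  have h256' : (u ^ 256)⁻¹ ≤ (u ^ 12)⁻¹ :=
    inv_anti₀ (by positivity) (pow_le_pow_right₀ hu1 (by norm_num))
  rw [e1] at t1 t2
  rw [e16] at t3 t4
  rw [e64] at hE
  rw [e256]
  have b1 : 2 * (1 / 2 : ℝ) ^ s₀ * (3 / 2) ^ (s₀ + 2 * m) ≤ 2 * (u ^ 12)⁻¹ := by linarith
  have b2 : 4 * α * (1 / 2) ^ (2 * m) * (9 / 8) ^ n ≤ 12 * (u ^ 12)⁻¹ := by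
    refine t2.trans ?_
    calc 4 * α * (3 * (u ^ 256)⁻¹) = 12 * (α * (u ^ 256)⁻¹) := by ring
      _ ≤ 12 * (u * (u ^ 13)⁻¹) := by
          refine mul_le_mul_of_nonneg_left (mul_le_mul hαe h256 (by positivity) hu0.le)
            (by norm_num)
      _ = 12 * (u ^ 12)⁻¹ := by field_simp
  have b3 : 2 * Real.exp (4 * α) * ((1 / 2) ^ ⌊x / 8⌋₊ + (1 - δ / 2) ^ m) ≤
      6 * (u ^ 12)⁻¹ := by
    have hnn : 0 ≤ (1 / 2 : ℝ) ^ ⌊x / 8⌋₊ + (1 - δ / 2) ^ m := by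
      have : 0 ≤ 1 - δ / 2 := by linarith
      positivity
    calc _ ≤ 2 * u ^ 4 * (2 * (u ^ 16)⁻¹ + (u ^ 16)⁻¹) :=
          mul_le_mul (by linarith) (add_le_add t3 t4) hnn (by positivity)
      _ = 6 * (u ^ 12)⁻¹ := by field_simp; norm_num
  calc _ ≤ u * (20 * (u ^ 12)⁻¹) := by
        refine mul_le_mul hαe (by linarith) ?_ hu0.le
        have : 0 ≤ 1 - δ / 2 := by linarith
        positivity
    _ = 20 / u ^ 10 * u⁻¹ := by field_simp
    _ ≤ 2 * u⁻¹ := by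
        refine mul_le_mul_of_nonneg_right ?_ (by positivity)
        rw [div_le_iff₀ (by positivity)]
        linarith

theorem scaled_fairBin_le {n : ℕ} (hn : Odd n) {c α : ℝ} (hα : 0 ≤ α)
    (hαc : α ≤ c * √(n : ℝ)) (i : ℕ) : α * fairBin n i ≤ c := by
  have hs : 0 < √(n : ℝ) := Real.sqrt_pos.2 (Nat.cast_pos.2 hn.pos)
  refine (mul_le_mul_of_nonneg_left (fairBin_le hn i) hα).trans ?_
  rw [mul_one_div, div_le_iff₀ hs]
  exact hαc

theorem tvDist_traceLaw_le_exp {n : ℕ} (hn : Odd n) {α : ℝ} (hα : 0 ≤ α)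
    (hαn : α ≤ 1 / 256 * √(n : ℝ)) (he : ∀ i, evenString n α i ∈ Set.Icc (0 : ℝ) 1)
    (ho : ∀ i, oddString n α i ∈ Set.Icc (0 : ℝ) 1) (δ : unitInterval)
    (hδ : 256 / √(n : ℝ) ≤ (δ : ℝ)) :
    tvDist (traceLaw δ (toProbString (evenString n α) he))
      (traceLaw δ (toProbString (oddString n α) ho)) ≤ Real.exp (-(1 / 256 * √(n : ℝ))) := by
  have hs : 0 < √(n : ℝ) := Real.sqrt_pos.2 (Nat.cast_pos.2 hn.pos)
  -- Since `δ ≤ 1`, the lower bound on `δ` rules out small `n`.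
  have hx : 256 ≤ √(n : ℝ) := by
    have := hδ.trans δ.2.2
    rwa [div_le_one hs] at this
  refine (tvDist_traceLaw_le (n := n) (h := 2 * (n / 8)) (M := n / 8) (s₀ := n - 3 * (n / 8))
    hn.pos (by omega) hα (fun i => (scaled_fairBin_le hn hα hαn i).trans (by norm_num)) δ he
    ho).trans ?_
  have := trace_bound_le_exp (n := n) rfl hx hα hαn hδ δ.2.2 rfl
    (s₀ := n - 3 * (n / 8)) (by omega)
  linarith

theorem abs_evenString_sub_oddString (n : ℕ) {α : ℝ} (hα : 0 ≤ α) (i : Fin (n + 1)) :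
    |evenString n α i - oddString n α i| = α * fairBin n i := by
  have h0 := mul_nonneg hα (fairBin_nonneg n i)
  rw [evenString_eq, oddString_eq, parityString, parityString]
  rcases Nat.mod_two_eq_zero_or_one (i : ℕ) with h | h
  · rw [if_pos (by omega), if_neg (by omega), sub_zero, abs_of_nonneg h0]
  · rw [if_neg (by omega), if_pos (by omega), zero_sub, abs_neg, abs_of_nonneg h0]

theorem l1Dist_evenString_oddString (n : ℕ) {α : ℝ} (hα : 0 ≤ α) :
    l1Dist (evenString n α) (oddString n α) = α := by
  simp_rw [l1Dist, abs_evenString_sub_oddString n hα]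
  rw [Fin.sum_univ_eq_sum_range (fun i => α * fairBin n i), ← Finset.mul_sum]
  have := binAvg_const n (1 : ℝ)
  simp only [binAvg, smul_eq_mul, mul_one] at this
  rw [this, mul_one]

theorem linfDist_evenString_oddString_le {n : ℕ} (hn : Odd n) {α : ℝ} (hα : 0 ≤ α) :
    linfDist (evenString n α) (oddString n α) ≤ α / √(n : ℝ) := by
  refine ciSup_le fun i => ?_
  rw [abs_evenString_sub_oddString n hα, ← mul_one_div]
  exact mul_le_mul_of_nonneg_left (fairBin_le hn i) hα

theorem abs_sub_le_linfDist {m : ℕ} (u v : Fin m → ℝ) (i : Fin m) :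
    |u i - v i| ≤ linfDist u v :=
  le_ciSup (f := fun i => |u i - v i|) (Set.finite_range _).bddAbove i

theorem le_linfDist_evenString_oddString {n : ℕ} (hn : Odd n) {α : ℝ} (hα : 0 ≤ α) :
    1 / 2 * (α / √(n : ℝ)) ≤ linfDist (evenString n α) (oddString n α) := by
  obtain ⟨m, rfl⟩ := hn
  refine le_trans ?_ (abs_sub_le_linfDist _ _ (⟨m, by omega⟩ : Fin (2 * m + 1 + 1)))
  rw [abs_evenString_sub_oddString _ hα, ← mul_one_div α, mul_left_comm]
  exact mul_le_mul_of_nonneg_left (le_fairBin_middle m) hα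

theorem linfDist_triangle {m : ℕ} [NeZero m] (u v w : Fin m → ℝ) :
    linfDist v w ≤ linfDist u v + linfDist u w := by
  refine ciSup_le fun i => ?_
  have h := abs_sub_le (v i) (u i) (w i)
  rw [abs_sub_comm (v i) (u i)] at h
  exact h.trans (add_le_add (abs_sub_le_linfDist u v i) (abs_sub_le_linfDist u w i))

theorem l1Dist_triangle {m : ℕ} (u v w : Fin m → ℝ) :
    l1Dist v w ≤ l1Dist u v + l1Dist u w := by
  rw [l1Dist, l1Dist, l1Dist, ← Finset.sum_add_distrib]
  refine Finset.sum_le_sum fun i _ => ?_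
  have h := abs_sub_le (v i) (u i) (w i)
  rwa [abs_sub_comm (v i) (u i)] at h

theorem measurableSet_linfDist_le {m : ℕ} [NeZero m] (v : Fin m → ℝ) (r : ℝ) :
    MeasurableSet {u | linfDist u v ≤ r} := by
  have e : {u | linfDist u v ≤ r} = ⋂ i, {u : Fin m → ℝ | |u i - v i| ≤ r} := by
    ext u
    simp only [Set.mem_ofPred_eq, Set.mem_iInter]
    exact ciSup_le_iff (Set.finite_range _).bddAbove
  rw [e]
  exact MeasurableSet.iInter fun i =>
    (isClosed_le (by fun_prop) continuous_const).measurableSet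

theorem measurableSet_l1Dist_le {m : ℕ} (v : Fin m → ℝ) (r : ℝ) :
    MeasurableSet {u | l1Dist u v ≤ r} := by
  unfold l1Dist
  exact (isClosed_le (by fun_prop) continuous_const).measurableSet

/-- An estimator that separates two strings with close trace laws needs many traces. -/
theorem sample_lower_bound {δ : unitInterval} {m : ℕ} {S T : ProbString m} {t : ℕ}
    {A : Estimator m} {q L : ℝ} {G H : Set (Fin m → ℝ)} (hGH : Disjoint G H)
    (hH : MeasurableSet H) (htv : tvDist (traceLaw δ S) (traceLaw δ T) ≤ Real.exp (-L))
    (hG : q ≤ successProb δ S t A G) (hH' : q ≤ successProb δ T t A H) :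
    (q - 1 / 2) * Real.exp L ≤ t := by
  have h := successProb_add_le δ S T t A hGH hH
  have h1 : (t : ℝ) * (2 * tvDist (traceLaw δ S) (traceLaw δ T)) ≤ t * (2 * Real.exp (-L)) :=
    mul_le_mul_of_nonneg_left (by linarith) (Nat.cast_nonneg t)
  have h2 : q - 1 / 2 ≤ t * Real.exp (-L) := by linarith
  calc (q - 1 / 2) * Real.exp L ≤ t * Real.exp (-L) * Real.exp L :=
        mul_le_mul_of_nonneg_right h2 (Real.exp_pos _).le
    _ = t := by rw [mul_assoc, ← Real.exp_add]; simp

end Main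

theorem theorem3 :
    ∃ c > (0 : ℝ), ∃ c' > (0 : ℝ), ∃ c'' > (0 : ℝ), ∃ κ > (0 : ℝ), ∃ ε > (0 : ℝ),
      (∀ n : ℕ, Odd n → ∀ α : ℝ, 0 ≤ α → α ≤ c' * √(n : ℝ) →
        ∃ (he : ∀ i, evenString n α i ∈ Set.Icc (0 : ℝ) 1)
          (ho : ∀ i, oddString n α i ∈ Set.Icc (0 : ℝ) 1),
          (∀ δ : unitInterval, c / √(n : ℝ) ≤ (δ : ℝ) →
            tvDist (traceLaw δ (toProbString (evenString n α) he))
                (traceLaw δ (toProbString (oddString n α) ho)) ≤ Real.exp (-(c'' * √(n : ℝ))) ∧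
            ∀ (t : ℕ) (A : Distinguisher),
              guessProb δ (toProbString (evenString n α) he) (toProbString (oddString n α) ho) t A
                ≤ 1 / 2 + t * Real.exp (-(c'' * √(n : ℝ)))) ∧
          l1Dist (evenString n α) (oddString n α) = α ∧
          κ * (α / √(n : ℝ)) ≤ linfDist (evenString n α) (oddString n α) ∧
          linfDist (evenString n α) (oddString n α) ≤ α / √(n : ℝ)) ∧
      (∀ n : ℕ, Odd n → ∀ δ : unitInterval, c / √(n : ℝ) ≤ (δ : ℝ) →
        ∀ (t : ℕ) (A : Estimator (n + 1)) (q : ℝ),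
          ((∀ S : ProbString (n + 1),
              q ≤ successProb δ S t A {u | linfDist u S.toReal ≤ ε}) →
            (q - 1 / 2) * Real.exp (c'' * √(n : ℝ)) ≤ t) ∧
          ((∀ S : ProbString (n + 1),
              q ≤ successProb δ S t A {u | l1Dist u S.toReal ≤ ε * √(n : ℝ)}) →
            (q - 1 / 2) * Real.exp (c'' * √(n : ℝ)) ≤ t)) := by
  have hmem : ∀ n : ℕ, Odd n → ∀ α : ℝ, 0 ≤ α → α ≤ 1 / 256 * √(n : ℝ) → ∀ r i,
      parityString n α r i ∈ Set.Icc (0 : ℝ) 1 := fun n hn α hα hαn r i =>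
    ⟨parityString_nonneg hα r i, (parityString_le hα r i).trans
      ((scaled_fairBin_le hn hα hαn i).trans (by norm_num))⟩
  have heven : ∀ n : ℕ, Odd n → ∀ α : ℝ, 0 ≤ α → α ≤ 1 / 256 * √(n : ℝ) → ∀ i,
      evenString n α i ∈ Set.Icc (0 : ℝ) 1 := fun n hn α hα hαn i => by
    rw [evenString_eq]; exact hmem n hn α hα hαn _ _
  have hodd : ∀ n : ℕ, Odd n → ∀ α : ℝ, 0 ≤ α → α ≤ 1 / 256 * √(n : ℝ) → ∀ i,
      oddString n α i ∈ Set.Icc (0 : ℝ) 1 := fun n hn α hα hαn i => by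
    rw [oddString_eq]; exact hmem n hn α hα hαn _ _
  -- The radius `ε = 1 / 2048` keeps the balls around the two strings disjoint: for `α = √n / 256`
  -- their distances are at least `1 / 512` in ℓ^∞ and equal to `√n / 256` in ℓ¹.
  refine ⟨256, by norm_num, 1 / 256, by norm_num, 1 / 256, by norm_num, 1 / 2, by norm_num,
    1 / 2048, by norm_num, ?_, ?_⟩
  · intro n hn α hα hαn
    refine ⟨heven n hn α hα hαn, hodd n hn α hα hαn, fun δ hδ => ?_,
      l1Dist_evenString_oddString n hα, le_linfDist_evenString_oddString hn hα,
      linfDist_evenString_oddString_le hn hα⟩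
    have htv := tvDist_traceLaw_le_exp hn hα hαn (heven n hn α hα hαn) (hodd n hn α hα hαn) δ hδ
    exact ⟨htv, fun t A => (guessProb_le δ _ _ t A).trans
      (add_le_add le_rfl (mul_le_mul_of_nonneg_left htv (Nat.cast_nonneg t)))⟩
  · intro n hn δ hδ t A q
    have hs : 0 < √(n : ℝ) := Real.sqrt_pos.2 (Nat.cast_pos.2 hn.pos)
    have hα : 0 ≤ 1 / 256 * √(n : ℝ) := by positivity
    have he := heven n hn _ hα le_rfl
    have ho := hodd n hn _ hα le_rfl
    have htv := tvDist_traceLaw_le_exp hn hα le_rfl he ho δ hδ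
    constructor
    · intro h
      refine sample_lower_bound ?_ (measurableSet_linfDist_le _ _) htv (h _) (h _)
      rw [Set.disjoint_left]
      intro u hu hu'
      have h1 := linfDist_triangle u (evenString n (1 / 256 * √(n : ℝ)))
        (oddString n (1 / 256 * √(n : ℝ)))
      have h2 := le_linfDist_evenString_oddString hn hα
      rw [mul_div_assoc, div_self hs.ne'] at h2
      have h3 : linfDist u (evenString n (1 / 256 * √(n : ℝ))) ≤ 1 / 2048 := hu
      have h4 : linfDist u (oddString n (1 / 256 * √(n : ℝ))) ≤ 1 / 2048 := hu'
      linarith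
    · intro h
      refine sample_lower_bound ?_ (measurableSet_l1Dist_le _ _) htv (h _) (h _)
      rw [Set.disjoint_left]
      intro u hu hu'
      have h1 := l1Dist_triangle u (evenString n (1 / 256 * √(n : ℝ)))
        (oddString n (1 / 256 * √(n : ℝ)))
      rw [l1Dist_evenString_oddString n hα] at h1
      have h3 : l1Dist u (evenString n (1 / 256 * √(n : ℝ))) ≤ 1 / 2048 * √(n : ℝ) := hu
      have h4 : l1Dist u (oddString n (1 / 256 * √(n : ℝ))) ≤ 1 / 2048 * √(n : ℝ) := hu'
      linarith
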